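/- Let $\mathcal B:D(\mathcal B)\subseteq X\to X$ be a linear operator on a complex Banach space $X$ (not necessarily bounded or densely defined). Let $\omega\in(0,\pi)$, $\lambda_0>0$ and $\Sigma_\omega=\{z\in\mathbb C:\pi-|\arg z|<\omega\}$. Suppose that the resolvent set of $\mathcal B$ contains $\Sigma_\omega\cup\{z:|z|<\lambda_0\}$, and that $z(z\mathcal I-\mathcal B)^{-1}$ is bounded on every smaller sector: for each $\eta\in(0,\omega)$, $\sup_{z\in\Sigma_\eta}\|z(z\mathcal I-\mathcal B)^{-1}\|<\infty$. Let $\alpha\in(0,1)$. The power $\mathcal B^\alpha$ is defined by the Dunford–Taylor integral of $z^\alpha$ (principal branch) in its usual regularized form $$\mathcal B^\alpha=\mathcal B\,\mathcal B^{\alpha-1},\qquad \mathcal B^{\alpha-1}=\frac1{2\pi\mathrm i}\int_{\mathcal C}z^{\alpha-1}(z\mathcal I-\mathcal B)^{-1}\,dz,\qquad D(\mathcal B^\alpha)=\{x\in X:\mathcal B^{\alpha-1}x\in D(\mathcal B)\},$$ where $\mathcal C=\mathcal C_{\delta,\theta}$ comes in from infinity along the ray $\arg z=\theta$ down to $|z|=\delta$,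 follows the circle $|z|=\delta$ clockwise to $\arg z=-\theta$, and goes out to infinity along the ray $\arg z=-\theta$, with $0<\delta<\lambda_0$ and $\pi-\omega<\theta<\pi$. Then, for every such choice of $\delta$ and $\theta$, the integral defining $\mathcal B^{\alpha-1}$ converges absolutely in operator norm, and for every $t\ge 0$ the operator $\mathcal B^\alpha+t\mathcal I:D(\mathcal B^\alpha)\to X$ has an everywhere defined bounded inverse, given by $$(\mathcal B^\alpha+t\mathcal I)^{-1}=\frac{\sin\pi\alpha}{\pi}\int_0^\infty(\rho+\mathcal B)^{-1}\,\frac{\rho^\alpha}{\rho^{2\alpha}+2t\rho^\alpha\cos\pi\alpha+t^2}\,d\rho ,$$ where the integral converges absolutely in operator norm. For $t=0$ this is the Balakrishnan formula $$(\mathcal B^\alpha)^{-1}=\frac{\sin\pi\alpha}{\pi}\int_0^\infty\rho^{-\alpha}(\rho+\mathcal B)^{-1}\,d\rho .$$ -/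

import Mathlib

open Set MeasureTheory

namespace UnboundedOp

variable {X : Type*} [NormedAddCommGroup X] [NormedSpace ℂ X]

/-- The operator `z I + T`, with domain `D(T)`. -/
noncomputable def addScalar (z : ℂ) (T : X →ₗ.[ℂ] X) : X →ₗ.[ℂ] X :=
  (z • (LinearMap.id : X →ₗ[ℂ] X)) +ᵥ T

/-- `R` is a bounded, everywhere defined inverse of the operator `T : D(T) → X`:
`R` maps `X` into `D(T)`, `T R = I` on `X` and `R T = I` on `D(T)`. -/
def IsBoundedInverse (T : X →ₗ.[ℂ] X) (R : X →L[ℂ] X) : Prop :=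
  (∀ x : X, ∃ h : R x ∈ T.domain, T ⟨R x, h⟩ = x) ∧ ∀ x : T.domain, R (T x) = (x : X)

/-- A bounded inverse is unique. -/
theorem IsBoundedInverse.unique {T : X →ₗ.[ℂ] X} {R S : X →L[ℂ] X}
    (hR : IsBoundedInverse T R) (hS : IsBoundedInverse T S) : R = S := by
  ext x
  obtain ⟨h, hx⟩ := hR.1 x
  have h2 := hS.2 ⟨R x, h⟩
  rw [hx] at h2
  exact h2.symm

open Classical in
/-- The bounded inverse `T⁻¹` (the zero operator when there is none). -/
noncomputable def boundedInverse (T : X →ₗ.[ℂ] X) : X →L[ℂ] X :=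
  if h : ∃ R : X →L[ℂ] X, IsBoundedInverse T R then h.choose else 0

theorem IsBoundedInverse.boundedInverse_eq {T : X →ₗ.[ℂ] X} {R : X →L[ℂ] X}
    (hR : IsBoundedInverse T R) : boundedInverse T = R := by
  have h : ∃ R : X →L[ℂ] X, IsBoundedInverse T R := ⟨R, hR⟩
  rw [boundedInverse, dif_pos h]
  exact h.choose_spec.unique hR

/-- The resolvent set of `B`: all `z` for which `z I - B` has a bounded inverse. -/
def resolventSetOf (B : X →ₗ.[ℂ] X) : Set ℂ :=
  {z | ∃ R : X →L[ℂ] X, IsBoundedInverse (addScalar z (-B)) R}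

/-- The resolvent `(z I - B)⁻¹`. -/
noncomputable def resolventOf (B : X →ₗ.[ℂ] X) (z : ℂ) : X →L[ℂ] X :=
  boundedInverse (addScalar z (-B))

/-- The sector `Σ_ω = {z : π - |arg z| < ω}` around the negative real axis. -/
def negSector (ω : ℝ) : Set ℂ := {z | Real.pi - |z.arg| < ω}

section Contour

variable {E : Type*} [NormedAddCommGroup E] [NormedSpace ℂ E]

/-- The point of modulus `r` on the ray with angle `φ`. -/
noncomputable def rayPoint (r φ : ℝ) : ℂ := (r : ℂ) * Complex.exp ((φ : ℂ) * Complex.I)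

/-- The integral `∫ F(z) dz` along the contour that comes in along the ray `arg z = θ` from infinity
to modulus `δ`, follows the circle `|z| = δ` clockwise from angle `θ` to angle `-θ`, and
goes out to infinity along the ray `arg z = -θ`. -/
noncomputable def keyholeIntegral (δ θ : ℝ) (F : ℂ → E) : E :=
  -(∫ r in Ioi δ, Complex.exp ((θ : ℂ) * Complex.I) • F (rayPoint r θ))
    + (∫ φ in θ..(-θ), (Complex.I * rayPoint δ φ) • F (rayPoint δ φ))
    + ∫ r in Ioi δ, Complex.exp (((-θ : ℝ) : ℂ) * Complex.I) • F (rayPoint r (-θ))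

/-- Absolute convergence of the integral along the same contour. -/
def KeyholeIntegrable (δ θ : ℝ) (F : ℂ → E) : Prop :=
  IntegrableOn (fun r : ℝ => F (rayPoint r θ)) (Ioi δ) ∧
  IntervalIntegrable (fun φ : ℝ => F (rayPoint δ φ)) volume θ (-θ) ∧
  IntegrableOn (fun r : ℝ => F (rayPoint r (-θ))) (Ioi δ)

end Contour

/-- The Dunford-Taylor integral `(2πi)⁻¹ ∫ z ^ s (z I - B)⁻¹ dz` over the contour of `keyholeIntegral`,
with the principal branch of `z ^ s`. -/
noncomputable def dunfordTaylor (B : X →ₗ.[ℂ] X) (δ θ s : ℝ) : X →L[ℂ] X :=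
  (2 * (Real.pi : ℂ) * Complex.I)⁻¹ •
    keyholeIntegral δ θ (fun z : ℂ => z ^ (s : ℂ) • resolventOf B z)

/-- The fractional power `B^α`, `0 < α < 1`: the Dunford-Taylor integral of `z ^ α`, read in the usual
regularized way as `B^α = B B^(α-1)` with the absolutely convergent integral
`B^(α-1) = (2πi)⁻¹ ∫ z ^ (α - 1) (z I - B)⁻¹ dz`. Its domain is the natural one,
`D(B^α) = {x : B^(α-1) x ∈ D(B)}`. -/
noncomputable def fracPower (B : X →ₗ.[ℂ] X) (δ θ α : ℝ) : X →ₗ.[ℂ] X where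
  domain := B.domain.comap (dunfordTaylor B δ θ (α - 1) : X →ₗ[ℂ] X)
  toFun := B.toFun ∘ₗ
    (dunfordTaylor B δ θ (α - 1) : X →ₗ[ℂ] X).restrict (fun _ hx => hx)

theorem fracPower_apply (B : X →ₗ.[ℂ] X) (δ θ α : ℝ) (x : (fracPower B δ θ α).domain) :
    fracPower B δ θ α x = B ⟨dunfordTaylor B δ θ (α - 1) (x : X), x.2⟩ := rfl

end UnboundedOp

/-! Write `R(z)` for `(zI - B)⁻¹`, `A = B⁻¹ = -R(0)`, `S = B^(α-1)`, and `T` for the Balakrishnan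
integral (`balakrishnan`). Everything reduces to one identity between bounded operators, `(S + tA) T
= A`, together with the fact that `T` commutes with `S` and `A`;
`isBoundedInverse_addScalar_fracPower` turns these into the statement about the unbounded operator
`B^α + t`.

The scalar input is the Stieltjes representation `integral_fracKernel_mul_inv_add`: the kernel of
`T` is, up to a constant, the jump of `(z^α + t)⁻¹` across the negative axis, so its integral
against `(z + ρ)⁻¹` reproduces `(z^α + t)⁻¹` on the slit plane. Integrating the resolvent identity
for `R(z) (ρ + B)⁻¹` against this kernel (`resolventOf_mul_balakrishnan`) gives `R(z) T = (z^α +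
t)⁻¹ R(z) + c H(z)` with `c = sin(πα)/π`, where `H` is the Stieltjes transform of the integrand of
`T`.

The contour integrand of `S + tA` is `g(z) R(z)` with `g(z) = z^(α-1) + t/z = (z^α + t)/z`. Hence
`g(z) R(z) T = z⁻¹ R(z) + c g(z) H(z)`. The second term is holomorphic on the slit plane and decays
like `|z|^(α-2)`, so closing the contour to the right gives zero (`keyholeIntegral_eq_zero`). The
first term is holomorphic across the negative axis, so closing to the left leaves the residue at
`0`, which is `A` after normalization (`keyholeIntegral_inv_smul`). No double contour integral or
interchange of integrals is needed. -/

namespace UnboundedOp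

/-! ### Resolvents of an unbounded operator, and reduction to bounded operators. -/

section Resolvent

variable {X : Type*} [NormedAddCommGroup X] [NormedSpace ℂ X] {B : X →ₗ.[ℂ] X}

theorem isBoundedInverse_addScalar_iff {z : ℂ} {T : X →ₗ.[ℂ] X} {R : X →L[ℂ] X} :
    IsBoundedInverse (addScalar z T) R ↔
      (∀ x : X, ∃ h : R x ∈ T.domain, z • R x + T ⟨R x, h⟩ = x) ∧
        ∀ x : T.domain, R (z • (x : X) + T x) = x := Iff.rfl

theorem isBoundedInverse_addScalar_neg_iff {z : ℂ} {R : X →L[ℂ] X} :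
    IsBoundedInverse (addScalar z (-B)) R ↔
      (∀ x : X, ∃ h : R x ∈ B.domain, z • R x - B ⟨R x, h⟩ = x) ∧
        ∀ x : B.domain, R (z • (x : X) - B x) = x := by
  simp only [sub_eq_add_neg]
  exact Iff.rfl

theorem isBoundedInverse_addScalar_zero_iff {T : X →ₗ.[ℂ] X} {R : X →L[ℂ] X} :
    IsBoundedInverse (addScalar 0 T) R ↔ IsBoundedInverse T R := by
  rw [isBoundedInverse_addScalar_iff]
  simp only [zero_smul, zero_add]
  exact Iff.rfl

theorem isBoundedInverse_resolventOf {z : ℂ} (hz : z ∈ resolventSetOf B) :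
    IsBoundedInverse (addScalar z (-B)) (resolventOf B z) := by
  obtain ⟨R, hR⟩ := hz
  rw [resolventOf, hR.boundedInverse_eq]
  exact hR

theorem isBoundedInverse_neg_resolventOf_neg {z : ℂ} (hz : -z ∈ resolventSetOf B) :
    IsBoundedInverse (addScalar z B) (-resolventOf B (-z)) := by
  have h := isBoundedInverse_addScalar_neg_iff.1 (isBoundedInverse_resolventOf hz)
  refine isBoundedInverse_addScalar_iff.2 ⟨fun x => ?_, fun x => ?_⟩
  · obtain ⟨hx, hx'⟩ := h.1 x
    refine ⟨B.domain.neg_mem hx, ?_⟩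
    have : (⟨(-resolventOf B (-z)) x, B.domain.neg_mem hx⟩ : B.domain)
        = -⟨resolventOf B (-z) x, hx⟩ := rfl
    rw [this, LinearPMap.map_neg]
    simpa [sub_eq_add_neg] using hx'
  · have hx := h.2 x
    have : -z • (x : X) - B x = -(z • (x : X) + B x) := by rw [neg_smul]; abel
    rw [this, map_neg] at hx
    exact hx

theorem boundedInverse_addScalar {z : ℂ} (hz : -z ∈ resolventSetOf B) :
    boundedInverse (addScalar z B) = -resolventOf B (-z) :=
  (isBoundedInverse_neg_resolventOf_neg hz).boundedInverse_eq

/-- The first resolvent identity. -/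
theorem resolventOf_sub {z w : ℂ} (hz : z ∈ resolventSetOf B) (hw : w ∈ resolventSetOf B) :
    resolventOf B z - resolventOf B w = (w - z) • (resolventOf B z * resolventOf B w) := by
  have hz' := isBoundedInverse_addScalar_neg_iff.1 (isBoundedInverse_resolventOf hz)
  have hw' := isBoundedInverse_addScalar_neg_iff.1 (isBoundedInverse_resolventOf hw)
  ext x
  obtain ⟨h, hx⟩ := hw'.1 x
  have h2 := hz'.2 ⟨_, h⟩
  have h3 : z • resolventOf B w x - B ⟨resolventOf B w x, h⟩
      = x - (w - z) • resolventOf B w x := by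
    nth_rw 3 [← hx]
    rw [sub_smul]; abel
  simp only [h3, map_sub, map_smul] at h2
  simp only [sub_apply, smul_apply,
    mul_apply_eq_comp]
  rw [sub_eq_iff_eq_add] at h2 ⊢
  exact h2.trans (add_comm _ _)

theorem resolventOf_commute {z w : ℂ} (hz : z ∈ resolventSetOf B) (hw : w ∈ resolventSetOf B) :
    Commute (resolventOf B z) (resolventOf B w) := by
  rcases eq_or_ne z w with rfl | hne
  · exact Commute.refl _
  · have h1 := resolventOf_sub hz hw
    have h2 := resolventOf_sub hw hz
    have h3 : (w - z) • (resolventOf B z * resolventOf B w)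
        = (w - z) • (resolventOf B w * resolventOf B z) := by
      rw [← h1, ← neg_sub (resolventOf B w), h2, ← neg_smul, neg_sub]
    exact smul_right_injective _ (sub_ne_zero.2 hne.symm) h3

/-- The resolvent identity as a partial fraction decomposition, with `(w + B)⁻¹` written as `-(-w -
B)⁻¹`. -/
theorem resolventOf_mul_neg_resolventOf_neg {z w : ℂ} (hz : z ∈ resolventSetOf B)
    (hw : -w ∈ resolventSetOf B) (hzw : z + w ≠ 0) :
    resolventOf B z * -resolventOf B (-w)
      = (z + w)⁻¹ • (resolventOf B z + -resolventOf B (-w)) := by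
  rw [← sub_eq_add_neg, resolventOf_sub hz hw, smul_smul, mul_neg, ← neg_one_smul ℂ]
  congr 1
  field_simp
  ring

/-- With `R = (z₀ - B)⁻¹` and `U = 1 + (z - z₀) R` one has `(z - B) R = U`, and `U` is invertible
for `z` near `z₀`; so `R U⁻¹` is a right inverse. It is a left inverse too, because every element of
`D(B)` has the form `R y`. -/
theorem resolventOf_eventuallyEq [CompleteSpace X] {z₀ : ℂ} (hz : z₀ ∈ resolventSetOf B) :
    resolventOf B =ᶠ[nhds z₀] fun z =>
      resolventOf B z₀ * Ring.inverse (1 + (z - z₀) • resolventOf B z₀) := by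
  have hcont : ContinuousAt (fun z : ℂ => 1 + (z - z₀) • resolventOf B z₀) z₀ := by fun_prop
  have h1 : {U : X →L[ℂ] X | IsUnit U} ∈ nhds (1 + (z₀ - z₀) • resolventOf B z₀) := by
    rw [sub_self, zero_smul, add_zero]
    exact Units.isOpen.mem_nhds isUnit_one
  filter_upwards [hcont h1] with z hU
  change IsUnit _ at hU
  have h0 := isBoundedInverse_addScalar_neg_iff.1 (isBoundedInverse_resolventOf hz)
  set R := resolventOf B z₀
  set U := 1 + (z - z₀) • R with hUdef
  have hUl : ∀ x, U (Ring.inverse U x) = x := fun x => by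
    rw [← mul_apply_eq_comp, Ring.mul_inverse_cancel _ hU,
      one_apply_eq_self]
  have hUr : ∀ x, Ring.inverse U (U x) = x := fun x => by
    rw [← mul_apply_eq_comp, Ring.inverse_mul_cancel _ hU,
      one_apply_eq_self]
  have key : ∀ y (h : R y ∈ B.domain), z₀ • R y - B ⟨R y, h⟩ = y →
      z • R y - B ⟨R y, h⟩ = U y := by
    intro y h hy
    have : U y = y + (z - z₀) • R y := rfl
    rw [this]
    nth_rw 3 [← hy]
    rw [sub_smul]; abel
  refine IsBoundedInverse.boundedInverse_eq (isBoundedInverse_addScalar_neg_iff.2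
    ⟨fun x => ?_, fun x => ?_⟩)
  · obtain ⟨h, hx⟩ := h0.1 (Ring.inverse U x)
    exact ⟨h, (key _ h hx).trans (hUl x)⟩
  · obtain ⟨y, hy⟩ : ∃ y, R y = x := ⟨_, h0.2 x⟩
    obtain ⟨h, hy'⟩ := h0.1 y
    have hx : x = ⟨R y, h⟩ := Subtype.ext hy.symm
    rw [hx]
    change R (Ring.inverse U (z • R y - B ⟨R y, h⟩)) = R y
    rw [key y h hy', hUr]

theorem differentiableAt_resolventOf [CompleteSpace X] {z : ℂ} (hz : z ∈ resolventSetOf B) :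
    DifferentiableAt ℂ (resolventOf B) z := by
  refine DifferentiableAt.congr_of_eventuallyEq ?_ (resolventOf_eventuallyEq hz)
  refine (differentiableAt_const _).mul ?_
  have h1 : DifferentiableAt ℂ (Ring.inverse : (X →L[ℂ] X) → X →L[ℂ] X)
      (1 + (z - z) • resolventOf B z) := by
    have : 1 + (z - z) • resolventOf B z = ((1 : (X →L[ℂ] X)ˣ) : X →L[ℂ] X) := by simp
    rw [this]
    exact differentiableAt_inverse (𝕜 := ℂ) ⟨1, rfl⟩
  have h2 : DifferentiableAt ℂ (fun w : ℂ => 1 + (w - z) • resolventOf B z) z := by fun_prop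
  exact h1.comp z h2

/-- The product identity reads `S R x = A (x - t R x)`, so `S R x` lies in the range of `A`, which
is `D(B)`, and applying `B` gives `B^α R x = x - t R x`. For the other side, `A` is injective and
commutes with `R`, so it suffices to compare after applying `A`, where `A B^α x = S x`. -/
theorem isBoundedInverse_addScalar_fracPower {δ θ α : ℝ} {t : ℂ} {A R : X →L[ℂ] X}
    (hA : IsBoundedInverse B A)
    (hmul : (dunfordTaylor B δ θ (α - 1) + t • A) * R = A)
    (hS : Commute (dunfordTaylor B δ θ (α - 1)) R) (hAR : Commute A R) :
    IsBoundedInverse (addScalar t (fracPower B δ θ α)) R := by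
  set S := dunfordTaylor B δ θ (α - 1) with hSdef
  have hinj : Function.Injective A := fun x y hxy => by
    obtain ⟨hx, hx'⟩ := hA.1 x
    obtain ⟨hy, hy'⟩ := hA.1 y
    rw [← hx', ← hy']
    congr 1
    exact Subtype.ext hxy
  refine isBoundedInverse_addScalar_iff.2 ⟨fun x => ?_, fun x => ?_⟩
  · have h1 : S (R x) = A (x - t • R x) := by
      have h2 := DFunLike.congr_fun hmul x
      simp only [mul_apply_eq_comp, add_apply,
        smul_apply] at h2
      rw [map_sub, map_smul, ← h2]; abel
    obtain ⟨h, hx⟩ := hA.1 (x - t • R x)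
    have hmem : S (R x) ∈ B.domain := h1 ▸ h
    refine ⟨hmem, ?_⟩
    have h3 : fracPower B δ θ α ⟨R x, hmem⟩ = x - t • R x := by
      rw [fracPower_apply, ← hx]
      congr 1
      exact Subtype.ext h1
    rw [h3]; abel
  · have hx : S (x : X) ∈ B.domain := x.2
    have h1 : A (fracPower B δ θ α x) = S x := by
      rw [fracPower_apply]
      exact hA.2 ⟨_, hx⟩
    apply hinj
    rw [← mul_apply_eq_comp, hAR.eq, mul_apply_eq_comp, map_add, map_smul,
      h1]
    have h2 : Commute (S + t • A) R := hS.add_left (hAR.smul_left t)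
    have h3 := DFunLike.congr_fun (h2.eq.symm.trans hmul) (x : X)
    simp only [mul_apply_eq_comp, add_apply,
        smul_apply] at h3
    exact (congrArg R (add_comm _ _)).trans h3

end Resolvent

/-! ### Polar coordinates and Cauchy's theorem on annular sectors. -/

section Polar

variable {E : Type*} [NormedAddCommGroup E] [NormedSpace ℂ E]

theorem exp_log_add_mul_I {r : ℝ} (hr : 0 < r) (φ : ℝ) :
    Complex.exp ((Real.log r : ℂ) + (φ : ℂ) * Complex.I) = rayPoint r φ := by
  rw [Complex.exp_add, ← Complex.ofReal_exp, Real.exp_log hr, rayPoint]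

theorem norm_rayPoint {r : ℝ} (hr : 0 ≤ r) (φ : ℝ) : ‖rayPoint r φ‖ = r := by
  rw [rayPoint, norm_mul, Complex.norm_exp_ofReal_mul_I, mul_one, Complex.norm_real,
    Real.norm_of_nonneg hr]

theorem circleMap_zero_eq_rayPoint (r φ : ℝ) : circleMap 0 r φ = rayPoint r φ := by
  simp [circleMap, rayPoint]

theorem rayPoint_add_two_pi (r φ : ℝ) : rayPoint r (φ + 2 * Real.pi) = rayPoint r φ := by
  simp only [← circleMap_zero_eq_rayPoint]
  exact periodic_circleMap 0 r φ

theorem rayPoint_pi (r : ℝ) : rayPoint r Real.pi = -r := by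
  simp [rayPoint]

theorem rayPoint_neg_pi (r : ℝ) : rayPoint r (-Real.pi) = -r := by
  rw [← rayPoint_pi, ← rayPoint_add_two_pi r (-Real.pi)]
  congr 1
  ring

theorem continuous_rayPoint_left (φ : ℝ) : Continuous fun r : ℝ => rayPoint r φ := by
  unfold rayPoint; fun_prop

theorem continuous_rayPoint_right (r : ℝ) : Continuous fun φ : ℝ => rayPoint r φ := by
  unfold rayPoint; fun_prop

theorem norm_rayPoint_add_sq (r t φ : ℝ) :
    ‖rayPoint r φ + t‖ ^ 2 = r ^ 2 + 2 * r * t * Real.cos φ + t ^ 2 := by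
  have h : rayPoint r φ + t = ⟨r * Real.cos φ + t, r * Real.sin φ⟩ := by
    apply Complex.ext <;> simp [rayPoint, Complex.exp_ofReal_mul_I_re, Complex.exp_ofReal_mul_I_im]
  rw [h, ← Complex.normSq_eq_norm_sq, Complex.normSq_mk]
  linear_combination r ^ 2 * Real.sin_sq_add_cos_sq φ

/-- The identity behind it is `|r e^(iφ) + t|² - cos²(φ/2) (r + t)² = sin²(φ/2) (r - t)²`. All later
lower bounds for denominators come from this one. -/
theorem cos_half_mul_add_le_norm {r t φ θ : ℝ} (hr : 0 ≤ r) (ht : 0 ≤ t) (hφ : |φ| ≤ θ)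
    (hθ : θ ≤ Real.pi) : Real.cos (θ / 2) * (r + t) ≤ ‖rayPoint r φ + t‖ := by
  have h1 : Real.cos (θ / 2) ≤ Real.cos (φ / 2) := by
    rw [← Real.cos_abs (φ / 2), abs_div, abs_two]
    exact Real.cos_le_cos_of_nonneg_of_le_pi (by positivity) (by linarith [Real.pi_pos])
      (by linarith)
  have h2 : Real.cos (φ / 2) * (r + t) ≤ ‖rayPoint r φ + t‖ := by
    refine (abs_le_of_sq_le_sq' ?_ (norm_nonneg _)).2
    rw [norm_rayPoint_add_sq]
    have h3 : Real.cos φ = 2 * Real.cos (φ / 2) ^ 2 - 1 := by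
      rw [← Real.cos_two_mul]; congr 1; ring
    have h4 : Real.cos (φ / 2) ^ 2 ≤ 1 := Real.cos_sq_le_one _
    rw [h3]
    nlinarith [mul_nonneg (sub_nonneg.2 h4) (sq_nonneg (r - t))]
  exact (mul_le_mul_of_nonneg_right h1 (by positivity)).trans h2

theorem cos_half_pos {θ : ℝ} (h0 : 0 ≤ θ) (hθ : θ < Real.pi) : 0 < Real.cos (θ / 2) :=
  Real.cos_pos_of_mem_Ioo ⟨by linarith [Real.pi_pos], by linarith⟩

theorem arg_rayPoint {r φ : ℝ} (hr : 0 < r) (hφ : φ ∈ Ioc (-Real.pi) Real.pi) :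
    (rayPoint r φ).arg = φ := by
  rw [rayPoint, Complex.exp_mul_I]
  exact Complex.arg_mul_cos_add_sin_mul_I hr hφ

theorem rayPoint_norm_arg (z : ℂ) : rayPoint ‖z‖ z.arg = z := Complex.norm_mul_exp_arg_mul_I z

theorem rayPoint_mem_slitPlane {r φ : ℝ} (hr : 0 < r) (hφ : |φ| < Real.pi) :
    rayPoint r φ ∈ Complex.slitPlane := by
  rw [abs_lt] at hφ
  have h0 : rayPoint r φ ≠ 0 := by
    rw [← norm_pos_iff, norm_rayPoint hr.le]; exact hr
  rw [Complex.mem_slitPlane_iff_arg, arg_rayPoint hr ⟨hφ.1, hφ.2.le⟩]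
  exact ⟨hφ.2.ne, h0⟩

/-- Cauchy's theorem for a sector of an annulus, in logarithmic coordinates. -/
theorem integral_boundary_annularSector_log {a b φ₁ φ₂ : ℝ} (ha : 0 < a) (hab : a ≤ b)
    (hφ : φ₁ ≤ φ₂) {G : ℂ → E}
    (hG : DifferentiableOn ℂ G (Icc (Real.log a) (Real.log b) ×ℂ Icc φ₁ φ₂)) :
    (∫ r in a..b, r⁻¹ • G (Real.log r + φ₁ * Complex.I))
      - (∫ r in a..b, r⁻¹ • G (Real.log r + φ₂ * Complex.I))
      + Complex.I • (∫ φ in φ₁..φ₂, G (Real.log b + φ * Complex.I))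
      - Complex.I • (∫ φ in φ₁..φ₂, G (Real.log a + φ * Complex.I)) = 0 := by
  have hlog : Real.log a ≤ Real.log b := Real.log_le_log ha hab
  have hrect := Complex.integral_boundary_rect_eq_zero_of_differentiableOn G
    ⟨Real.log a, φ₁⟩ ⟨Real.log b, φ₂⟩ (by simpa [uIcc_of_le hlog, uIcc_of_le hφ] using hG)
  have hsub : ∀ φ ∈ Icc φ₁ φ₂, ∫ r in a..b, r⁻¹ • G (Real.log r + φ * Complex.I)
      = ∫ x in Real.log a..Real.log b, G (x + φ * Complex.I) := by
    intro φ hφ'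
    refine intervalIntegral.integral_deriv_smul_comp' (f := Real.log) (f' := fun x => x⁻¹)
      (g := fun x : ℝ => G (x + φ * Complex.I)) ?_ ?_ ?_
    · intro x hx
      rw [uIcc_of_le hab] at hx
      exact Real.hasDerivAt_log (ha.trans_le hx.1).ne'
    · intro x hx
      rw [uIcc_of_le hab] at hx
      exact (continuousAt_inv₀ (ha.trans_le hx.1).ne').continuousWithinAt
    · refine hG.continuousOn.comp (Continuous.continuousOn (by fun_prop)) ?_
      rintro _ ⟨x, hx, rfl⟩
      rw [uIcc_of_le hab] at hx
      have := ha.trans_le hx.1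
      simpa [Complex.mem_reProdIm] using
        ⟨⟨Real.log_le_log ha hx.1, Real.log_le_log this hx.2⟩, hφ'⟩
  rw [hsub φ₁ (left_mem_Icc.2 hφ), hsub φ₂ (right_mem_Icc.2 hφ)]
  exact hrect

/-- Cauchy's theorem for a sector of an annulus. -/
theorem integral_boundary_annularSector {a b φ₁ φ₂ : ℝ} (ha : 0 < a) (hab : a ≤ b)
    (hφ : φ₁ ≤ φ₂) {F : ℂ → E}
    (hF : ∀ r ∈ Icc a b, ∀ φ ∈ Icc φ₁ φ₂, DifferentiableAt ℂ F (rayPoint r φ)) :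
    (∫ r in a..b, Complex.exp ((φ₁ : ℂ) * Complex.I) • F (rayPoint r φ₁))
      - (∫ r in a..b, Complex.exp ((φ₂ : ℂ) * Complex.I) • F (rayPoint r φ₂))
      + (∫ φ in φ₁..φ₂, (Complex.I * rayPoint b φ) • F (rayPoint b φ))
      - (∫ φ in φ₁..φ₂, (Complex.I * rayPoint a φ) • F (rayPoint a φ)) = 0 := by
  have h := integral_boundary_annularSector_log ha hab hφ
    (G := fun w => Complex.exp w • F (Complex.exp w)) ?_
  · have hray : ∀ φ : ℝ, (∫ r in a..b, r⁻¹ •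
        (Complex.exp (Real.log r + φ * Complex.I) • F (Complex.exp (Real.log r + φ * Complex.I))))
        = ∫ r in a..b, Complex.exp ((φ : ℂ) * Complex.I) • F (rayPoint r φ) := by
      intro φ
      refine intervalIntegral.integral_congr fun r hr => ?_
      rw [uIcc_of_le hab] at hr
      have hr0 := ha.trans_le hr.1
      have hrc : (r : ℂ) ≠ 0 := by exact_mod_cast hr0.ne'
      simp only [exp_log_add_mul_I hr0]
      rw [← Complex.coe_smul, smul_smul, rayPoint, Complex.ofReal_inv, inv_mul_cancel_left₀ hrc]
    simp only [hray, exp_log_add_mul_I ha, exp_log_add_mul_I (ha.trans_le hab)] at h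
    simpa only [mul_smul, intervalIntegral.integral_smul] using h
  · rintro w ⟨hw1, hw2⟩
    refine DifferentiableAt.differentiableWithinAt ?_
    have hexp : Complex.exp w = rayPoint (Real.exp w.re) w.im := by
      rw [← exp_log_add_mul_I (Real.exp_pos _), Real.log_exp, Complex.re_add_im]
    have hd := hF (Real.exp w.re) ⟨(Real.log_le_iff_le_exp ha).1 hw1.1,
      (Real.le_log_iff_exp_le (ha.trans_le hab)).1 hw1.2⟩ w.im hw2
    rw [← hexp] at hd
    exact Complex.differentiableAt_exp.smul (hd.comp w Complex.differentiableAt_exp)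

theorem integral_arc_eq_circleIntegral (r c : ℝ) (F : ℂ → E) :
    ∫ φ in c..c + 2 * Real.pi, (Complex.I * rayPoint r φ) • F (rayPoint r φ)
      = ∮ z in C(0, r), F z := by
  have hper : Function.Periodic (fun φ : ℝ => (Complex.I * rayPoint r φ) • F (rayPoint r φ))
      (2 * Real.pi) := fun φ => by simp only [rayPoint_add_two_pi]
  rw [hper.intervalIntegral_add_eq c 0, zero_add, circleIntegral]
  simp only [deriv_circleMap, circleMap_zero_eq_rayPoint, mul_comm]

end Polar

/-! ### A residue formula on the strip `|Im w| ≤ π`, in the coordinate `w = log ζ`. -/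

section Stieltjes

/-- The imaginary parts differ by strictly less than `2π`. One closed and one open strip suffice:
`w` must reach the two sides of the cut, while `w₀` is the logarithm of a point off the cut. -/
theorem eq_of_exp_eq_of_mem_strip {w w₀ : ℂ} (hw : |w.im| ≤ Real.pi) (hw₀ : |w₀.im| < Real.pi)
    (h : Complex.exp w = Complex.exp w₀) : w = w₀ := by
  obtain ⟨n, hn⟩ := Complex.exp_eq_exp_iff_exists_int.1 h
  have him : w.im = w₀.im + n * (2 * Real.pi) := by
    rw [hn]; simp
  rw [abs_le] at hw
  rw [abs_lt] at hw₀
  have hpi := Real.pi_pos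
  have h1 : (n : ℝ) < 1 := by
    by_contra! hc
    nlinarith
  have h2 : (-1 : ℝ) < n := by
    by_contra! hc
    nlinarith
  have hn0 : n = 0 := by
    have h1' : n < 1 := by exact_mod_cast h1
    have h2' : -1 < n := by exact_mod_cast h2
    omega
  rw [hn, hn0]; simp

theorem dslope_exp_ne_zero {w w₀ : ℂ} (hw : |w.im| ≤ Real.pi) (hw₀ : |w₀.im| < Real.pi) :
    dslope Complex.exp w₀ w ≠ 0 := by
  rcases eq_or_ne w w₀ with rfl | hne
  · rw [dslope_same, Complex.deriv_exp]
    exact Complex.exp_ne_zero _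
  · rw [dslope_of_ne _ hne, slope_def_field]
    refine div_ne_zero (sub_ne_zero.2 fun h => hne ?_) (sub_ne_zero.2 hne)
    exact eq_of_exp_eq_of_mem_strip hw hw₀ h

theorem dslope_div_dslope_exp_mul {f : ℂ → ℂ} {w w₀ : ℂ} (hne : w ≠ w₀) :
    dslope f w₀ w / dslope Complex.exp w₀ w * Complex.exp w
      = (f w - f w₀) * (Complex.exp w / (Complex.exp w - Complex.exp w₀)) := by
  rw [dslope_of_ne _ hne, dslope_of_ne _ hne, slope_def_field, slope_def_field,
    div_div_div_cancel_right₀ (sub_ne_zero.2 hne)]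
  ring

theorem rayPoint_sub_ne_zero {r φ : ℝ} {z : ℂ} (hr : 0 ≤ r) (hz : r ≠ ‖z‖) :
    rayPoint r φ - z ≠ 0 := fun h => hz <| by
  rw [← norm_rayPoint hr φ, sub_eq_zero.1 h]

theorem continuous_rayPoint_div_sub {r : ℝ} {z : ℂ} (hr : 0 ≤ r) (hz : r ≠ ‖z‖) :
    Continuous fun φ : ℝ => rayPoint r φ / (rayPoint r φ - z) :=
  (continuous_rayPoint_right r).div ((continuous_rayPoint_right r).sub continuous_const)
    fun _ => rayPoint_sub_ne_zero hr hz

theorem I_mul_integral_rayPoint_div_sub (r : ℝ) (z : ℂ) :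
    Complex.I * ∫ φ in -Real.pi..Real.pi, rayPoint r φ / (rayPoint r φ - z)
      = ∮ ζ in C(0, r), (ζ - z)⁻¹ := by
  rw [← integral_arc_eq_circleIntegral r (-Real.pi), ← intervalIntegral.integral_const_mul]
  have : -Real.pi + 2 * Real.pi = Real.pi := by ring
  rw [this]
  simp only [smul_eq_mul, mul_assoc, div_eq_mul_inv]

theorem I_mul_integral_rayPoint_div_sub_of_norm_lt {r : ℝ} {z : ℂ} (hz : ‖z‖ < r) :
    Complex.I * ∫ φ in -Real.pi..Real.pi, rayPoint r φ / (rayPoint r φ - z)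
      = 2 * Real.pi * Complex.I := by
  rw [I_mul_integral_rayPoint_div_sub]
  exact circleIntegral.integral_sub_inv_of_mem_ball (by simpa using hz)

theorem I_mul_integral_rayPoint_div_sub_of_lt_norm {r : ℝ} {z : ℂ} (hr : 0 ≤ r) (hz : r < ‖z‖) :
    Complex.I * ∫ φ in -Real.pi..Real.pi, rayPoint r φ / (rayPoint r φ - z) = 0 := by
  rw [I_mul_integral_rayPoint_div_sub]
  have hd : ∀ ζ ∈ Metric.closedBall (0 : ℂ) r, DifferentiableAt ℂ (fun ζ : ℂ => (ζ - z)⁻¹) ζ := by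
    intro ζ hζ
    refine DifferentiableAt.inv (by fun_prop) (sub_ne_zero.2 ?_)
    rintro rfl
    rw [mem_closedBall_zero_iff] at hζ
    exact absurd hζ hz.not_ge
  exact Complex.circleIntegral_eq_zero_of_differentiable_on_off_countable hr countable_empty
    (fun ζ hζ => (hd ζ hζ).continuousAt.continuousWithinAt)
    fun ζ hζ => hd ζ (Metric.ball_subset_closedBall hζ.1)

/-- The cut annulus becomes a rectangle, and `f` may take different values on the two sides of the
cut. The pole of `f(w) e^w / (e^w - z)` at `w₀ = log z` is removed by subtracting `f(w₀)` from `f`;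
Cauchy's theorem applies to the rest, and the subtracted constant is accounted for by circle
integrals of `(ζ - z)⁻¹`. -/
theorem integral_strip_boundary_eq_residue {f : ℂ → ℂ} {U : Set ℂ} (hU : IsOpen U)
    (hstrip : ∀ w : ℂ, |w.im| ≤ Real.pi → w ∈ U) (hf : DifferentiableOn ℂ f U) {z : ℂ}
    (hz : z ∈ Complex.slitPlane) {a b : ℝ} (ha : 0 < a) (haz : a < ‖z‖) (hzb : ‖z‖ < b) :
    (∫ r in a..b, (f (Real.log r + (-Real.pi : ℝ) * Complex.I)
        - f (Real.log r + Real.pi * Complex.I)) * (z + r)⁻¹)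
      + Complex.I * (∫ φ in -Real.pi..Real.pi,
          f (Real.log b + φ * Complex.I) * (rayPoint b φ / (rayPoint b φ - z)))
      - Complex.I * (∫ φ in -Real.pi..Real.pi,
          f (Real.log a + φ * Complex.I) * (rayPoint a φ / (rayPoint a φ - z)))
      = 2 * Real.pi * Complex.I * f (Complex.log z) := by
  have hpi := Real.pi_pos
  have hab : a < b := haz.trans hzb
  have hb : 0 < b := ha.trans hab
  set w₀ := Complex.log z with hw₀
  have hz0 : z ≠ 0 := Complex.slitPlane_ne_zero hz
  have hexp : Complex.exp w₀ = z := Complex.exp_log hz0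
  have him : |w₀.im| < Real.pi := by
    rw [hw₀, Complex.log_im, abs_lt]
    exact ⟨Complex.neg_pi_lt_arg z,
      lt_of_le_of_ne (Complex.arg_le_pi z) (Complex.mem_slitPlane_iff_arg.1 hz).1⟩
  -- Writing `(f(w) - f(w₀)) / (e^w - z)` as a quotient of divided differences makes it holomorphic
  -- at `w₀` as well.
  set Q : ℂ → ℂ := fun w => dslope f w₀ w / dslope Complex.exp w₀ w * Complex.exp w with hQ
  have hQd : DifferentiableOn ℂ Q
      (Icc (Real.log a) (Real.log b) ×ℂ Icc (-Real.pi) Real.pi) := by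
    rintro w ⟨-, hw⟩
    have hw' : |w.im| ≤ Real.pi := abs_le.2 hw
    have h1 : DifferentiableAt ℂ (dslope f w₀) w :=
      ((Complex.differentiableOn_dslope (hU.mem_nhds (hstrip w₀ him.le))).2 hf).differentiableAt
        (hU.mem_nhds (hstrip w hw'))
    have h2 : DifferentiableAt ℂ (dslope Complex.exp w₀) w :=
      ((Complex.differentiableOn_dslope Filter.univ_mem).2
        Complex.differentiable_exp.differentiableOn).differentiableAt Filter.univ_mem
    exact ((h1.div h2 (dslope_exp_ne_zero hw' him)).mul
      Complex.differentiableAt_exp).differentiableWithinAt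
  have hcauchy := integral_boundary_annularSector_log ha hab.le (by linarith) hQd
  have hQedge : ∀ {r : ℝ} (φ : ℝ), 0 < r → Real.log r + φ * Complex.I ≠ w₀ →
      Q (Real.log r + φ * Complex.I) = (f (Real.log r + φ * Complex.I) - f w₀)
        * (rayPoint r φ / (rayPoint r φ - z)) := by
    intro r φ hr hne
    rw [hQ]
    simp only
    rw [dslope_div_dslope_exp_mul hne, hexp, exp_log_add_mul_I hr]
  have hfc : ∀ {r : ℝ}, ContinuousOn (fun φ : ℝ => f (Real.log r + φ * Complex.I))
      (uIcc (-Real.pi) Real.pi) := by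
    intro r
    rw [uIcc_of_le (by linarith)]
    refine hf.continuousOn.comp (Continuous.continuousOn (by fun_prop)) fun φ hφ => ?_
    exact hstrip _ (by simpa [abs_le] using hφ)
  have harc : ∀ {r : ℝ}, 0 < r → r ≠ ‖z‖ →
      (∫ φ in -Real.pi..Real.pi, Q (Real.log r + φ * Complex.I))
      = (∫ φ in -Real.pi..Real.pi,
          f (Real.log r + φ * Complex.I) * (rayPoint r φ / (rayPoint r φ - z)))
        - f w₀ * ∫ φ in -Real.pi..Real.pi, rayPoint r φ / (rayPoint r φ - z) := by
    intro r hr hrz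
    have hc := continuous_rayPoint_div_sub hr.le hrz
    rw [← intervalIntegral.integral_const_mul, ← intervalIntegral.integral_sub]
    · refine intervalIntegral.integral_congr fun φ hφ => ?_
      rw [hQedge φ hr, sub_mul]
      intro h
      apply hrz
      rw [← norm_rayPoint hr.le φ, ← exp_log_add_mul_I hr, h, hexp]
    · exact (hfc.mul hc.continuousOn).intervalIntegrable
    · exact (hc.const_mul _).intervalIntegrable _ _
  have hray : ∀ (φ : ℝ), |φ| = Real.pi →
      IntervalIntegrable (fun r : ℝ => r⁻¹ • Q (Real.log r + φ * Complex.I)) volume a b := by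
    intro φ hφ
    apply ContinuousOn.intervalIntegrable
    rw [uIcc_of_le hab.le]
    have hinv : ContinuousOn (fun r : ℝ => r⁻¹) (Icc a b) := fun r hr =>
      (continuousAt_inv₀ (ha.trans_le hr.1).ne').continuousWithinAt
    refine hinv.smul (ContinuousOn.comp (g := Q)
      (f := fun r : ℝ => (Real.log r : ℂ) + φ * Complex.I) hQd.continuousOn ?_ fun r hr => ?_)
    · intro r hr
      have := (Real.continuousAt_log (ha.trans_le hr.1).ne')
      have h2 : ContinuousAt (fun r : ℝ => (Real.log r : ℂ) + φ * Complex.I) r :=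
        (Complex.continuous_ofReal.continuousAt.comp this).add continuousAt_const
      exact h2.continuousWithinAt
    · have hr0 := ha.trans_le hr.1
      have := abs_le.1 hφ.le
      simpa [Complex.mem_reProdIm] using
        ⟨⟨Real.log_le_log ha hr.1, Real.log_le_log hr0 hr.2⟩, this⟩
  rw [← intervalIntegral.integral_sub (hray _ (by rw [abs_neg, abs_of_pos hpi]))
    (hray _ (abs_of_pos hpi)), harc ha haz.ne, harc hb hzb.ne'] at hcauchy
  -- Both edges lie over the same points `ζ = -r`, so the subtracted constant `f w₀` cancels and
  -- only the jump of `f` remains.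
  have hedge : (∫ r in a..b, (r⁻¹ • Q (Real.log r + (-Real.pi : ℝ) * Complex.I)
      - r⁻¹ • Q (Real.log r + Real.pi * Complex.I)))
      = ∫ r in a..b, (f (Real.log r + (-Real.pi : ℝ) * Complex.I)
        - f (Real.log r + Real.pi * Complex.I)) * (z + r)⁻¹ := by
    refine intervalIntegral.integral_congr fun r hr => ?_
    rw [uIcc_of_le hab.le] at hr
    have hr0 := ha.trans_le hr.1
    have hrc : (r : ℂ) ≠ 0 := by exact_mod_cast hr0.ne'
    have hne : ∀ φ : ℝ, |φ| = Real.pi → Real.log r + φ * Complex.I ≠ w₀ := by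
      intro φ hφ h
      rw [← h] at him
      simp [hφ] at him
    have hzr : z + r ≠ 0 := by
      intro h
      rw [eq_neg_of_add_eq_zero_left h] at hz
      rcases hz with hz | hz
      · simp at hz; linarith
      · simp at hz
    rw [hQedge _ hr0 (hne _ (by rw [abs_neg, abs_of_pos hpi])),
      hQedge _ hr0 (hne _ (abs_of_pos hpi)), rayPoint_pi, rayPoint_neg_pi, Complex.real_smul,
      Complex.real_smul]
    have h3 : (-r : ℂ) - z ≠ 0 := by
      intro h; apply hzr; linear_combination -h
    push_cast
    field_simp
    ring
  rw [hedge] at hcauchy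
  simp only [smul_eq_mul] at hcauchy
  -- The constant `f w₀` contributes `2πi f w₀` on the outer circle, which encloses `z`, and nothing
  -- on the inner one.
  have h1 := I_mul_integral_rayPoint_div_sub_of_norm_lt hzb
  have h2 := I_mul_integral_rayPoint_div_sub_of_lt_norm ha.le haz
  linear_combination hcauchy + f w₀ * h1 - f w₀ * h2

end Stieltjes

/-! ### The kernel and the Stieltjes representation of `(z^α + t)⁻¹`. -/

section Kernel

variable {E : Type*} [NormedAddCommGroup E] [NormedSpace ℂ E]

/-- The density in the Stieltjes representation of `(z ^ α + t)⁻¹`, without the factor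
`sin (π α) / π`. -/
noncomputable def fracKernel (α t ρ : ℝ) : ℝ :=
  ρ ^ α / (ρ ^ (2 * α) + 2 * t * Real.cos (Real.pi * α) * ρ ^ α + t ^ 2)

variable {α t : ℝ}

theorem fracKernel_eq {ρ : ℝ} (hρ : 0 < ρ) :
    fracKernel α t ρ = ρ ^ α / ‖rayPoint (ρ ^ α) (Real.pi * α) + t‖ ^ 2 := by
  rw [norm_rayPoint_add_sq, fracKernel, mul_comm 2 α, ← Nat.cast_ofNat (n := 2),
    Real.rpow_mul_natCast hρ.le]
  push_cast
  ring_nf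

theorem cos_half_pi_mul_pos (hα : 0 < α) (hα1 : α < 1) : 0 < Real.cos (Real.pi * α / 2) :=
  cos_half_pos (by positivity) (by nlinarith [Real.pi_pos])

/-- Since `α < 1`, the angle `αφ` stays in `[-πα, πα]`, away from `±π`, so adding `t ≥ 0` cannot
produce cancellation. The bound is uniform in `t`. -/
theorem cos_mul_rpow_le_norm (hα : 0 < α) (hα1 : α < 1) (ht : 0 ≤ t) {r φ : ℝ} (hr : 0 ≤ r)
    (hφ : |φ| ≤ Real.pi) :
    Real.cos (Real.pi * α / 2) * r ≤ ‖rayPoint r (α * φ) + t‖ := by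
  have h1 : |α * φ| ≤ Real.pi * α := by
    rw [abs_mul, abs_of_pos hα, mul_comm]
    exact mul_le_mul_of_nonneg_right hφ hα.le
  refine le_trans ?_ (cos_half_mul_add_le_norm hr ht h1 (by nlinarith [Real.pi_pos]))
  have := cos_half_pi_mul_pos hα hα1
  nlinarith

theorem fracKernel_nonneg {ρ : ℝ} (hρ : 0 < ρ) : 0 ≤ fracKernel α t ρ := by
  rw [fracKernel_eq hρ]; positivity

theorem fracKernel_le (hα : 0 < α) (hα1 : α < 1) (ht : 0 ≤ t) {ρ : ℝ} (hρ : 0 < ρ) :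
    fracKernel α t ρ ≤ (Real.cos (Real.pi * α / 2) ^ 2)⁻¹ * ρ ^ (-α) := by
  have hc := cos_half_pi_mul_pos hα hα1
  have hp : 0 < ρ ^ α := Real.rpow_pos_of_pos hρ α
  have h := cos_mul_rpow_le_norm hα hα1 ht hp.le (abs_of_pos Real.pi_pos).le
  rw [mul_comm α] at h
  rw [fracKernel_eq hρ, Real.rpow_neg hρ.le]
  calc ρ ^ α / ‖rayPoint (ρ ^ α) (Real.pi * α) + t‖ ^ 2
      ≤ ρ ^ α / (Real.cos (Real.pi * α / 2) * ρ ^ α) ^ 2 := by gcongr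
    _ = _ := by field_simp

theorem measurable_fracKernel : Measurable (fracKernel α t) := by
  unfold fracKernel; fun_prop

/-- The common majorant: `ρ^(-α)` is integrable at `0` because `α < 1`, and `ρ^(-α-1)` at infinity
because `α > 0`. -/
theorem integrableOn_rpow_neg_mul_inv_one_add (hα : 0 < α) (hα1 : α < 1) :
    IntegrableOn (fun ρ : ℝ => ρ ^ (-α) * (1 + ρ)⁻¹) (Ioi 0) := by
  have hm : ∀ s : Set ℝ, AEStronglyMeasurable (fun ρ : ℝ => ρ ^ (-α) * (1 + ρ)⁻¹)
      (volume.restrict s) := fun s => by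
    apply Measurable.aestronglyMeasurable
    fun_prop
  rw [← Ioc_union_Ioi_eq_Ioi zero_le_one]
  refine IntegrableOn.union ?_ ?_
  · have h1 : IntegrableOn (fun ρ : ℝ => ρ ^ (-α)) (Ioc 0 1) :=
      (intervalIntegrable_iff_integrableOn_Ioc_of_le zero_le_one).1
        (intervalIntegral.intervalIntegrable_rpow' (by linarith))
    refine Integrable.mono' h1 (hm _) ?_
    filter_upwards [ae_restrict_mem measurableSet_Ioc] with ρ hρ
    have hp : 0 < ρ ^ (-α) := Real.rpow_pos_of_pos hρ.1 _
    have := hρ.1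
    rw [Real.norm_of_nonneg (by positivity)]
    exact mul_le_of_le_one_right hp.le (inv_le_one_of_one_le₀ (by linarith))
  · have h1 : IntegrableOn (fun ρ : ℝ => ρ ^ (-α - 1)) (Ioi 1) :=
      integrableOn_Ioi_rpow_of_lt (by linarith) one_pos
    refine Integrable.mono' h1 (hm _) ?_
    filter_upwards [ae_restrict_mem measurableSet_Ioi] with ρ hρ
    have h0 : 0 < ρ := one_pos.trans hρ
    have hp : 0 < ρ ^ (-α) := Real.rpow_pos_of_pos h0 _
    rw [Real.norm_of_nonneg (by positivity), Real.rpow_sub_one h0.ne', div_eq_mul_inv]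
    gcongr
    linarith

theorem integrableOn_fracKernel_smul (hα : 0 < α) (hα1 : α < 1) (ht : 0 ≤ t) {F : ℝ → E} {C : ℝ}
    (hF : ContinuousOn F (Ioi 0)) (hC : ∀ ρ : ℝ, 0 < ρ → ‖F ρ‖ ≤ C * (1 + ρ)⁻¹) :
    IntegrableOn (fun ρ : ℝ => (fracKernel α t ρ : ℂ) • F ρ) (Ioi 0) := by
  refine Integrable.mono' (((integrableOn_rpow_neg_mul_inv_one_add hα hα1).const_mul
    ((Real.cos (Real.pi * α / 2) ^ 2)⁻¹ * C))) ?_ ?_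
  · exact (Complex.continuous_ofReal.measurable.comp
      measurable_fracKernel).aestronglyMeasurable.smul
        (hF.aestronglyMeasurable measurableSet_Ioi)
  · filter_upwards [ae_restrict_mem measurableSet_Ioi] with ρ hρ
    rw [norm_smul, Complex.norm_real, Real.norm_of_nonneg (fracKernel_nonneg hρ)]
    have h1 := fracKernel_le hα hα1 ht hρ
    calc fracKernel α t ρ * ‖F ρ‖
        ≤ ((Real.cos (Real.pi * α / 2) ^ 2)⁻¹ * ρ ^ (-α)) * (C * (1 + ρ)⁻¹) :=
          mul_le_mul h1 (hC ρ hρ) (norm_nonneg _) ((fracKernel_nonneg hρ).trans h1)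
      _ = _ := by ring

/-- The function `(z ^ α + t)⁻¹` in the coordinate `w = log z`. -/
noncomputable def invPowAdd (α t : ℝ) (w : ℂ) : ℂ := (Complex.exp (α * w) + t)⁻¹

theorem exp_mul_eq_rayPoint (α : ℝ) (w : ℂ) :
    Complex.exp (α * w) = rayPoint (Real.exp (α * w.re)) (α * w.im) := by
  rw [rayPoint, Complex.ofReal_exp, ← Complex.exp_add]
  congr 1
  nth_rw 1 [← Complex.re_add_im w]
  push_cast
  ring

theorem exp_mul_log_add {r : ℝ} (hr : 0 < r) (α φ : ℝ) :
    Complex.exp (α * (Real.log r + φ * Complex.I)) = rayPoint (r ^ α) (α * φ) := by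
  rw [exp_mul_eq_rayPoint, Real.rpow_def_of_pos hr]
  simp [mul_comm]

theorem exp_mul_add_ne_zero (hα : 0 < α) (hα1 : α < 1) (ht : 0 ≤ t) {w : ℂ}
    (hw : |w.im| ≤ Real.pi) : Complex.exp (α * w) + t ≠ 0 := by
  rw [exp_mul_eq_rayPoint, ← norm_pos_iff]
  exact lt_of_lt_of_le (mul_pos (cos_half_pi_mul_pos hα hα1) (Real.exp_pos _))
    (cos_mul_rpow_le_norm hα hα1 ht (Real.exp_pos _).le hw)

theorem norm_invPowAdd_le (hα : 0 < α) (hα1 : α < 1) (ht : 0 ≤ t) {r φ : ℝ} (hr : 0 < r)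
    (hφ : |φ| ≤ Real.pi) :
    ‖invPowAdd α t (Real.log r + φ * Complex.I)‖ ≤ (Real.cos (Real.pi * α / 2) * r ^ α)⁻¹ := by
  have hp : 0 < r ^ α := Real.rpow_pos_of_pos hr α
  rw [invPowAdd, exp_mul_log_add hr, norm_inv]
  exact inv_anti₀ (mul_pos (cos_half_pi_mul_pos hα hα1) hp)
    (cos_mul_rpow_le_norm hα hα1 ht hp.le hφ)

/-- This jump across the cut is where the kernel comes from. -/
theorem invPowAdd_neg_pi_sub_pi (hα : 0 < α) (hα1 : α < 1) (ht : 0 ≤ t) {r : ℝ} (hr : 0 < r) :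
    invPowAdd α t (Real.log r + (-Real.pi : ℝ) * Complex.I)
      - invPowAdd α t (Real.log r + Real.pi * Complex.I)
      = 2 * Complex.I * Real.sin (Real.pi * α) * fracKernel α t r := by
  have hpi := Real.pi_pos
  have h1 := exp_mul_add_ne_zero hα hα1 ht (w := Real.log r + (-Real.pi : ℝ) * Complex.I)
    (by simp [abs_of_pos hpi])
  have h2 := exp_mul_add_ne_zero hα hα1 ht (w := Real.log r + Real.pi * Complex.I)
    (by simp [abs_of_pos hpi])
  have hr2 : r ^ (2 * α) = r ^ α * r ^ α := by rw [← Real.rpow_add hr]; ring_nf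
  have e1 : Complex.exp (α * (Real.log r + (-Real.pi : ℝ) * Complex.I))
      = (r ^ α : ℝ) * (Real.cos (Real.pi * α) - Real.sin (Real.pi * α) * Complex.I) := by
    rw [exp_mul_log_add hr, rayPoint, Complex.exp_mul_I, ← Complex.ofReal_cos,
      ← Complex.ofReal_sin, mul_neg, Real.cos_neg, Real.sin_neg, mul_comm α]
    push_cast
    ring
  have e2 : Complex.exp (α * (Real.log r + Real.pi * Complex.I))
      = (r ^ α : ℝ) * (Real.cos (Real.pi * α) + Real.sin (Real.pi * α) * Complex.I) := by
    rw [exp_mul_log_add hr, rayPoint, Complex.exp_mul_I, ← Complex.ofReal_cos,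
      ← Complex.ofReal_sin, mul_comm α]
  -- The two factors are complex conjugates; their product is the real denominator of the kernel.
  have hD : (Complex.exp (α * (Real.log r + (-Real.pi : ℝ) * Complex.I)) + t)
      * (Complex.exp (α * (Real.log r + Real.pi * Complex.I)) + t)
      = ((r ^ (2 * α) + 2 * t * Real.cos (Real.pi * α) * r ^ α + t ^ 2 : ℝ) : ℂ) := by
    have hs : (Real.sin (Real.pi * α) : ℂ) ^ 2 + (Real.cos (Real.pi * α) : ℂ) ^ 2 = 1 := by
      exact_mod_cast Real.sin_sq_add_cos_sq (Real.pi * α)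
    rw [e1, e2, hr2]
    generalize Real.sin (Real.pi * α) = s at hs ⊢
    generalize Real.cos (Real.pi * α) = c at hs ⊢
    generalize r ^ α = u
    push_cast
    linear_combination (u : ℂ) ^ 2 * hs - (u : ℂ) ^ 2 * (s : ℂ) ^ 2 * Complex.I_sq
  rw [invPowAdd, invPowAdd, inv_sub_inv h1 h2, hD, e1, e2, fracKernel, Complex.ofReal_div]
  ring

/-- The integrand is `O(b^(-α))`, since `|ζ / (ζ - z)| ≤ 2` once `|ζ| = b ≥ 2|z|`. -/
theorem tendsto_integral_invPowAdd_atTop (hα : 0 < α) (hα1 : α < 1) (ht : 0 ≤ t) (z : ℂ) :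
    Filter.Tendsto (fun b : ℝ => ∫ φ in -Real.pi..Real.pi,
      invPowAdd α t (Real.log b + φ * Complex.I) * (rayPoint b φ / (rayPoint b φ - z)))
      Filter.atTop (nhds 0) := by
  have hc := cos_half_pi_mul_pos hα hα1
  have hlim : Filter.Tendsto (fun b : ℝ => (Real.cos (Real.pi * α / 2))⁻¹ * b ^ (-α) * 2
      * |Real.pi - -Real.pi|) Filter.atTop (nhds 0) := by
    simpa using (((tendsto_rpow_neg_atTop hα).const_mul
      (Real.cos (Real.pi * α / 2))⁻¹).mul_const 2).mul_const |Real.pi - -Real.pi|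
  refine squeeze_zero_norm' ?_ hlim
  filter_upwards [Filter.eventually_gt_atTop (0 : ℝ), Filter.eventually_ge_atTop (2 * ‖z‖)]
    with b hb hbz
  refine intervalIntegral.norm_integral_le_of_norm_le_const fun φ hφ => ?_
  rw [uIoc_of_le (by linarith [Real.pi_pos])] at hφ
  have h1 := norm_invPowAdd_le hα hα1 ht hb (abs_le.2 ⟨hφ.1.le, hφ.2⟩)
  rw [mul_inv, ← Real.rpow_neg hb.le] at h1
  have h2 : b / 2 ≤ ‖rayPoint b φ - z‖ := by
    have := norm_sub_norm_le (rayPoint b φ) z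
    rw [norm_rayPoint hb.le] at this
    linarith
  rw [norm_mul, norm_div, norm_rayPoint hb.le]
  refine mul_le_mul h1 ?_ (by positivity) ((norm_nonneg _).trans h1)
  rw [div_le_iff₀ (by linarith)]
  linarith

/-- The factor `(ζ^α + t)⁻¹` may grow like `a^(-α)`, but `ζ / (ζ - z)` is `O(a)`, leaving `a^(1-α)`.
-/
theorem tendsto_integral_invPowAdd_zero (hα : 0 < α) (hα1 : α < 1) (ht : 0 ≤ t) {z : ℂ}
    (hz : z ≠ 0) :
    Filter.Tendsto (fun a : ℝ => ∫ φ in -Real.pi..Real.pi,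
      invPowAdd α t (Real.log a + φ * Complex.I) * (rayPoint a φ / (rayPoint a φ - z)))
      (nhdsWithin 0 (Ioi 0)) (nhds 0) := by
  have hc := cos_half_pi_mul_pos hα hα1
  have hzn : 0 < ‖z‖ := norm_pos_iff.2 hz
  have hlim : Filter.Tendsto (fun a : ℝ => (Real.cos (Real.pi * α / 2))⁻¹ * (2 / ‖z‖)
      * |Real.pi - -Real.pi| * a ^ (1 - α)) (nhdsWithin 0 (Ioi 0)) (nhds 0) := by
    have h1 : Filter.Tendsto (fun a : ℝ => a ^ (1 - α)) (nhdsWithin 0 (Ioi 0)) (nhds 0) := by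
      have := (Real.continuousAt_rpow_const 0 (1 - α) (Or.inr (by linarith))).tendsto
      rw [Real.zero_rpow (by linarith)] at this
      exact this.mono_left nhdsWithin_le_nhds
    simpa using h1.const_mul ((Real.cos (Real.pi * α / 2))⁻¹ * (2 / ‖z‖) * |Real.pi - -Real.pi|)
  refine squeeze_zero_norm' ?_ hlim
  filter_upwards [self_mem_nhdsWithin,
    nhdsWithin_le_nhds (Iio_mem_nhds (show (0 : ℝ) < ‖z‖ / 2 by positivity))] with a ha haz
  have ha0 : 0 < a := ha
  have haz' : a < ‖z‖ / 2 := haz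
  have hp : a ^ (1 - α) = a * (a ^ α)⁻¹ := by
    rw [Real.rpow_sub ha0, Real.rpow_one, div_eq_mul_inv]
  refine (intervalIntegral.norm_integral_le_of_norm_le_const
    (C := (Real.cos (Real.pi * α / 2) * a ^ α)⁻¹ * (2 / ‖z‖ * a)) fun φ hφ => ?_).trans_eq ?_
  · rw [uIoc_of_le (by linarith [Real.pi_pos])] at hφ
    have h1 := norm_invPowAdd_le hα hα1 ht ha0 (abs_le.2 ⟨hφ.1.le, hφ.2⟩)
    have h2 : ‖z‖ / 2 ≤ ‖rayPoint a φ - z‖ := by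
      have := norm_sub_norm_le z (rayPoint a φ)
      rw [norm_rayPoint ha0.le, norm_sub_rev] at this
      linarith
    rw [norm_mul, norm_div, norm_rayPoint ha0.le]
    refine mul_le_mul h1 ?_ (by positivity) ((norm_nonneg _).trans h1)
    rw [div_le_iff₀ (by linarith)]
    calc a = 2 / ‖z‖ * a * (‖z‖ / 2) := by field_simp
      _ ≤ _ := by gcongr
  · rw [hp, mul_inv]; ring

theorem cos_half_arg_pos {z : ℂ} (hz : z ∈ Complex.slitPlane) : 0 < Real.cos (z.arg / 2) := by
  rw [Complex.mem_slitPlane_iff_arg] at hz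
  exact Real.cos_pos_of_mem_Ioo ⟨by linarith [Complex.neg_pi_lt_arg z],
    by linarith [lt_of_le_of_ne (Complex.arg_le_pi z) hz.1]⟩

theorem cos_half_arg_mul_add_le_norm (z : ℂ) {ρ : ℝ} (hρ : 0 ≤ ρ) :
    Real.cos (z.arg / 2) * (‖z‖ + ρ) ≤ ‖z + ρ‖ := by
  have h := cos_half_mul_add_le_norm (norm_nonneg z) hρ le_rfl (Complex.abs_arg_le_pi z)
  rwa [rayPoint_norm_arg, show |z.arg| / 2 = |z.arg / 2| by rw [abs_div, abs_two], Real.cos_abs] at h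

theorem add_ofReal_ne_zero {z : ℂ} (hz : z ∈ Complex.slitPlane) {ρ : ℝ} (hρ : 0 ≤ ρ) :
    z + ρ ≠ 0 := by
  rw [← norm_pos_iff]
  refine lt_of_lt_of_le (mul_pos (cos_half_arg_pos hz) ?_) (cos_half_arg_mul_add_le_norm z hρ)
  have := norm_pos_iff.2 (Complex.slitPlane_ne_zero hz)
  linarith

theorem norm_inv_add_le {z : ℂ} (hz : z ∈ Complex.slitPlane) {ρ : ℝ} (hρ : 0 ≤ ρ) :
    ‖(z + ρ)⁻¹‖ ≤ (Real.cos (z.arg / 2) * min ‖z‖ 1)⁻¹ * (1 + ρ)⁻¹ := by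
  have h1 := cos_half_arg_pos hz
  have h2 := norm_pos_iff.2 (Complex.slitPlane_ne_zero hz)
  have h3 : 0 < min ‖z‖ 1 := lt_min h2 one_pos
  rw [norm_inv, ← mul_inv]
  refine inv_anti₀ (by positivity) (le_trans ?_ (cos_half_arg_mul_add_le_norm z hρ))
  rw [mul_assoc]
  refine mul_le_mul_of_nonneg_left ?_ h1.le
  have h4 : min ‖z‖ 1 ≤ ‖z‖ := min_le_left _ _
  have h5 : min ‖z‖ 1 ≤ 1 := min_le_right _ _
  nlinarith

theorem continuousOn_inv_add {z : ℂ} (hz : z ∈ Complex.slitPlane) :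
    ContinuousOn (fun ρ : ℝ => (z + ρ)⁻¹) (Ioi 0) :=
  ContinuousOn.inv₀ (by fun_prop) fun _ hρ => add_ofReal_ne_zero hz (le_of_lt hρ)

theorem integrableOn_fracKernel_mul_inv_add (hα : 0 < α) (hα1 : α < 1) (ht : 0 ≤ t) {z : ℂ}
    (hz : z ∈ Complex.slitPlane) :
    IntegrableOn (fun ρ : ℝ => (fracKernel α t ρ : ℂ) * (z + ρ)⁻¹) (Ioi 0) :=
  integrableOn_fracKernel_smul hα hα1 ht (continuousOn_inv_add hz)
    fun _ hρ => norm_inv_add_le hz (le_of_lt hρ)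

theorem aecover_Ioc_inv : AECover (volume.restrict (Ioi (0 : ℝ))) Filter.atTop
    fun N : ℝ => Ioc N⁻¹ N where
  ae_eventually_mem := by
    filter_upwards [ae_restrict_mem measurableSet_Ioi] with x hx
    filter_upwards [Filter.eventually_ge_atTop x,
      tendsto_inv_atTop_zero.eventually_lt_const (show (0 : ℝ) < x from hx)] with N h1 h2
    exact ⟨h2, h1⟩
  measurableSet _ := measurableSet_Ioc

/-- The Stieltjes representation of `(z ^ α + t)⁻¹`. -/
theorem integral_fracKernel_mul_inv_add (hα : 0 < α) (hα1 : α < 1) (ht : 0 ≤ t) {z : ℂ}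
    (hz : z ∈ Complex.slitPlane) :
    ((Real.sin (Real.pi * α) / Real.pi : ℝ) : ℂ)
      * ∫ ρ in Ioi (0 : ℝ), (fracKernel α t ρ : ℂ) * (z + ρ)⁻¹ = (z ^ (α : ℂ) + t)⁻¹ := by
  have hz0 := Complex.slitPlane_ne_zero hz
  have hzn : 0 < ‖z‖ := norm_pos_iff.2 hz0
  have hcpow : (z ^ (α : ℂ) + t)⁻¹ = invPowAdd α t (Complex.log z) := by
    rw [invPowAdd, Complex.cpow_def_of_ne_zero hz0, mul_comm]
  have hU : IsOpen {w : ℂ | Complex.exp (α * w) + t ≠ 0} :=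
    isOpen_ne_fun (by fun_prop) continuous_const
  have hd : DifferentiableOn ℂ (invPowAdd α t) {w : ℂ | Complex.exp (α * w) + t ≠ 0} := by
    intro w hw
    have h : DifferentiableAt ℂ (fun w : ℂ => Complex.exp (α * w) + t) w := by fun_prop
    exact (h.inv hw).differentiableWithinAt
  set I₀ := ∫ ρ in Ioi (0 : ℝ), (fracKernel α t ρ : ℂ) * (z + ρ)⁻¹ with hI₀
  have h1 : Filter.Tendsto (fun N : ℝ => ∫ ρ in N⁻¹..N,
      (invPowAdd α t (Real.log ρ + (-Real.pi : ℝ) * Complex.I)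
        - invPowAdd α t (Real.log ρ + Real.pi * Complex.I)) * (z + ρ)⁻¹) Filter.atTop
      (nhds (2 * Complex.I * Real.sin (Real.pi * α) * I₀)) := by
    have h := (aecover_Ioc_inv.integral_tendsto_of_countably_generated
      (integrableOn_fracKernel_mul_inv_add hα hα1 ht hz)).const_mul
        (2 * Complex.I * Real.sin (Real.pi * α))
    refine h.congr' ?_
    filter_upwards [Filter.eventually_ge_atTop (1 : ℝ)] with N hN
    have hN0 : 0 < N := one_pos.trans_le hN
    have hsub : Ioc N⁻¹ N ⊆ Ioi (0 : ℝ) := fun x hx => (inv_pos.2 hN0).trans hx.1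
    rw [intervalIntegral.integral_of_le ((inv_le_one_of_one_le₀ hN).trans hN),
      Measure.restrict_restrict_of_subset hsub, ← integral_const_mul]
    refine setIntegral_congr_fun measurableSet_Ioc fun ρ hρ => ?_
    rw [invPowAdd_neg_pi_sub_pi hα hα1 ht (hsub hρ)]
    ring
  have h2 := (tendsto_integral_invPowAdd_atTop hα hα1 ht z).const_mul Complex.I
  have h3 := ((tendsto_integral_invPowAdd_zero hα hα1 ht hz0).comp
    tendsto_inv_atTop_nhdsGT_zero).const_mul Complex.I
  have h4 := (h1.add h2).sub h3
  -- As soon as `1/N < |z| < N`, the residue formula makes the whole expression constant in `N`.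
  have h5 := h4.congr' (f₂ := fun _ => 2 * Real.pi * Complex.I * invPowAdd α t (Complex.log z)) (by
    filter_upwards [Filter.eventually_gt_atTop (0 : ℝ), Filter.eventually_gt_atTop ‖z‖,
      tendsto_inv_atTop_zero.eventually_lt_const hzn] with N hN hNz hzN
    exact integral_strip_boundary_eq_residue hU
      (fun w hw => exp_mul_add_ne_zero hα hα1 ht hw) hd hz (inv_pos.2 hN) hzN hNz)
  have h6 := tendsto_nhds_unique h5 tendsto_const_nhds
  rw [hcpow]
  have hpi : (Real.pi : ℂ) ≠ 0 := by exact_mod_cast Real.pi_ne_zero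
  have h7 : (2 * Real.pi * Complex.I) * (((Real.sin (Real.pi * α) / Real.pi : ℝ) : ℂ) * I₀)
      = (2 * Real.pi * Complex.I) * invPowAdd α t (Complex.log z) := by
    rw [← h6]
    push_cast
    field_simp
    ring
  exact mul_left_cancel₀ (by simp [hpi]) h7

end Kernel

/-! ### Calculus of keyhole integrals, and closing the contour to either side. -/

section Keyhole

variable {E : Type*} [NormedAddCommGroup E] [NormedSpace ℂ E]
variable {E' : Type*} [NormedAddCommGroup E'] [NormedSpace ℂ E']

/-- The points of the contour of `keyholeIntegral`. -/
def keyholePoints (δ θ : ℝ) : Set ℂ :=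
  {z | ∃ r φ : ℝ, z = rayPoint r φ ∧ δ ≤ r ∧ |φ| ≤ θ ∧ (r = δ ∨ |φ| = θ)}

variable {δ θ : ℝ}

theorem rayPoint_mem_keyholePoints (hθ : 0 ≤ θ) {r : ℝ} (hr : δ ≤ r) :
    rayPoint r θ ∈ keyholePoints δ θ :=
  ⟨r, θ, rfl, hr, (abs_of_nonneg hθ).le, Or.inr (abs_of_nonneg hθ)⟩

theorem rayPoint_neg_mem_keyholePoints (hθ : 0 ≤ θ) {r : ℝ} (hr : δ ≤ r) :
    rayPoint r (-θ) ∈ keyholePoints δ θ :=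
  ⟨r, -θ, rfl, hr, by rw [abs_neg, abs_of_nonneg hθ], Or.inr (by rw [abs_neg, abs_of_nonneg hθ])⟩

theorem arcPoint_mem_keyholePoints (hθ : 0 ≤ θ) {φ : ℝ} (hφ : φ ∈ uIcc θ (-θ)) :
    rayPoint δ φ ∈ keyholePoints δ θ := by
  rw [uIcc_of_ge (by linarith)] at hφ
  exact ⟨δ, φ, rfl, le_rfl, abs_le.2 hφ, Or.inl rfl⟩

theorem keyholePoints_subset_slitPlane (hδ : 0 < δ) (hθ : θ < Real.pi) :
    keyholePoints δ θ ⊆ Complex.slitPlane := by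
  rintro _ ⟨r, φ, rfl, hr, hφ, -⟩
  exact rayPoint_mem_slitPlane (hδ.trans_le hr) (hφ.trans_lt hθ)

theorem keyholeIntegral_congr (hθ : 0 ≤ θ) {F G : ℂ → E}
    (h : ∀ z ∈ keyholePoints δ θ, F z = G z) :
    keyholeIntegral δ θ F = keyholeIntegral δ θ G := by
  unfold keyholeIntegral
  congr 1
  · congr 1
    · congr 1
      refine setIntegral_congr_fun measurableSet_Ioi fun r hr => ?_
      simp only [h _ (rayPoint_mem_keyholePoints hθ (le_of_lt hr))]
    · refine intervalIntegral.integral_congr fun φ hφ => ?_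
      simp only [h _ (arcPoint_mem_keyholePoints hθ hφ)]
  · refine setIntegral_congr_fun measurableSet_Ioi fun r hr => ?_
    simp only [h _ (rayPoint_neg_mem_keyholePoints hθ (le_of_lt hr))]

theorem KeyholeIntegrable.congr (hθ : 0 ≤ θ) {F G : ℂ → E}
    (hF : KeyholeIntegrable δ θ F) (h : ∀ z ∈ keyholePoints δ θ, F z = G z) :
    KeyholeIntegrable δ θ G := by
  refine ⟨hF.1.congr_fun (fun r hr => h _ (rayPoint_mem_keyholePoints hθ (le_of_lt hr)))
    measurableSet_Ioi, hF.2.1.congr fun φ hφ => ?_,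
    hF.2.2.congr_fun (fun r hr => h _ (rayPoint_neg_mem_keyholePoints hθ (le_of_lt hr)))
    measurableSet_Ioi⟩
  exact h _ (arcPoint_mem_keyholePoints hθ (uIoc_subset_uIcc hφ))

theorem KeyholeIntegrable.smul_arc {F : ℂ → E} (hF : KeyholeIntegrable δ θ F) :
    IntervalIntegrable (fun φ : ℝ => (Complex.I * rayPoint δ φ) • F (rayPoint δ φ))
      volume θ (-θ) :=
  hF.2.1.continuousOn_smul ((continuous_rayPoint_right δ).const_mul _).continuousOn

theorem keyholeIntegral_add {F G : ℂ → E} (hF : KeyholeIntegrable δ θ F)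
    (hG : KeyholeIntegrable δ θ G) :
    keyholeIntegral δ θ (fun z => F z + G z)
      = keyholeIntegral δ θ F + keyholeIntegral δ θ G := by
  unfold keyholeIntegral
  simp only [integral_smul]
  rw [integral_add hF.1 hG.1, integral_add hF.2.2 hG.2.2]
  simp only [smul_add]
  rw [intervalIntegral.integral_add hF.smul_arc hG.smul_arc]
  abel

theorem keyholeIntegral_clm [CompleteSpace E] [CompleteSpace E'] (L : E →L[ℂ] E') {F : ℂ → E}
    (hF : KeyholeIntegrable δ θ F) :
    keyholeIntegral δ θ (fun z => L (F z)) = L (keyholeIntegral δ θ F) := by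
  unfold keyholeIntegral
  simp only [integral_smul]
  rw [map_add, map_add, map_neg, map_smul, map_smul, ← L.integral_comp_comm hF.1,
    ← L.integral_comp_comm hF.2.2, ← L.intervalIntegral_comp_comm hF.smul_arc]
  simp only [map_smul]

theorem integrableOn_ray (hδ : 0 < δ) {φ p C : ℝ} (hp : 1 < p) {F : ℂ → E}
    (hF : ContinuousOn (fun r : ℝ => F (rayPoint r φ)) (Ioi δ))
    (hC : ∀ r : ℝ, δ < r → ‖F (rayPoint r φ)‖ ≤ C * r ^ (-p)) :
    IntegrableOn (fun r : ℝ => F (rayPoint r φ)) (Ioi δ) := by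
  refine Integrable.mono' ((integrableOn_Ioi_rpow_of_lt (a := -p) (by linarith) hδ).const_mul C)
    (hF.aestronglyMeasurable measurableSet_Ioi) ?_
  filter_upwards [ae_restrict_mem measurableSet_Ioi] with r hr using hC r hr

theorem KeyholeIntegrable.of_norm_le (hδ : 0 < δ) (hθ : 0 ≤ θ) {p C : ℝ} (hp : 1 < p) {F : ℂ → E}
    (hF : ContinuousOn F (keyholePoints δ θ))
    (hC : ∀ z ∈ keyholePoints δ θ, ‖F z‖ ≤ C * ‖z‖ ^ (-p)) : KeyholeIntegrable δ θ F := by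
  refine ⟨integrableOn_ray (C := C) hδ hp ?_ fun r hr => ?_, ContinuousOn.intervalIntegrable ?_,
    integrableOn_ray (C := C) hδ hp ?_ fun r hr => ?_⟩
  · exact hF.comp (continuous_rayPoint_left θ).continuousOn
      fun r hr => rayPoint_mem_keyholePoints hθ (le_of_lt hr)
  · have h := hC _ (rayPoint_mem_keyholePoints hθ hr.le)
    rwa [norm_rayPoint (hδ.trans hr).le] at h
  · exact hF.comp (continuous_rayPoint_right δ).continuousOn
      fun φ hφ => arcPoint_mem_keyholePoints hθ hφ
  · exact hF.comp (continuous_rayPoint_left (-θ)).continuousOn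
      fun r hr => rayPoint_neg_mem_keyholePoints hθ (le_of_lt hr)
  · have h := hC _ (rayPoint_neg_mem_keyholePoints hθ hr.le)
    rwa [norm_rayPoint (hδ.trans hr).le] at h

/-- Cauchy's theorem for an unbounded sector with the tip removed. -/
theorem integral_ray_sub_integral_ray {φ₁ φ₂ p C : ℝ} (hδ : 0 < δ) (hφ : φ₁ ≤ φ₂) (hp : 1 < p)
    {F : ℂ → E}
    (hF : ∀ r : ℝ, δ ≤ r → ∀ φ ∈ Icc φ₁ φ₂, DifferentiableAt ℂ F (rayPoint r φ))
    (hC : ∀ r : ℝ, δ ≤ r → ∀ φ ∈ Icc φ₁ φ₂, ‖F (rayPoint r φ)‖ ≤ C * r ^ (-p)) :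
    (∫ r in Ioi δ, Complex.exp ((φ₁ : ℂ) * Complex.I) • F (rayPoint r φ₁))
      - (∫ r in Ioi δ, Complex.exp ((φ₂ : ℂ) * Complex.I) • F (rayPoint r φ₂))
      = ∫ φ in φ₁..φ₂, (Complex.I * rayPoint δ φ) • F (rayPoint δ φ) := by
  have hint : ∀ φ ∈ Icc φ₁ φ₂, IntegrableOn
      (fun r : ℝ => Complex.exp ((φ : ℂ) * Complex.I) • F (rayPoint r φ)) (Ioi δ) := by
    intro φ hφ'
    refine Integrable.smul _ (integrableOn_ray hδ hp (fun r hr => ?_)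
      fun r hr => hC r hr.le φ hφ')
    exact (ContinuousAt.comp (f := fun r : ℝ => rayPoint r φ)
      (hF r (le_of_lt hr) φ hφ').continuousAt
      (continuous_rayPoint_left φ).continuousAt).continuousWithinAt
  have h1 := intervalIntegral_tendsto_integral_Ioi δ (hint φ₁ (left_mem_Icc.2 hφ))
    Filter.tendsto_id
  have h2 := intervalIntegral_tendsto_integral_Ioi δ (hint φ₂ (right_mem_Icc.2 hφ))
    Filter.tendsto_id
  -- The arc at radius `b` contributes `O(b · b^(-p))`, which is where `p > 1` enters.
  have h3 : Filter.Tendsto (fun b : ℝ => ∫ φ in φ₁..φ₂, (Complex.I * rayPoint b φ) •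
      F (rayPoint b φ)) Filter.atTop (nhds 0) := by
    have hlim : Filter.Tendsto (fun b : ℝ => C * |φ₂ - φ₁| * b ^ (-(p - 1))) Filter.atTop
        (nhds 0) := by
      simpa using (tendsto_rpow_neg_atTop (sub_pos.2 hp)).const_mul (C * |φ₂ - φ₁|)
    refine squeeze_zero_norm' ?_ hlim
    filter_upwards [Filter.eventually_ge_atTop δ] with b hb
    have hb0 := hδ.trans_le hb
    refine (intervalIntegral.norm_integral_le_of_norm_le_const (C := b * (C * b ^ (-p)))
      fun φ hφ' => ?_).trans_eq ?_
    · rw [uIoc_of_le hφ] at hφ'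
      rw [norm_smul, norm_mul, Complex.norm_I, one_mul, norm_rayPoint hb0.le]
      exact mul_le_mul_of_nonneg_left (hC b hb φ ⟨hφ'.1.le, hφ'.2⟩) hb0.le
    · rw [neg_sub, show 1 - p = 1 + -p by ring, Real.rpow_add hb0, Real.rpow_one]
      ring
  have h4 := (h1.sub h2).add h3
  rw [add_zero] at h4
  refine tendsto_nhds_unique h4 (tendsto_const_nhds.congr' ?_)
  filter_upwards [Filter.eventually_ge_atTop δ] with b hb
  have h := integral_boundary_annularSector hδ hb hφ (F := F)
    fun r hr φ hφ' => hF r hr.1 φ hφ'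
  exact (sub_eq_zero.1 h).symm

theorem keyholeIntegral_eq_zero {p C : ℝ} (hδ : 0 < δ) (hθ : 0 ≤ θ) (hp : 1 < p) {F : ℂ → E}
    (hF : ∀ r : ℝ, δ ≤ r → ∀ φ : ℝ, |φ| ≤ θ → DifferentiableAt ℂ F (rayPoint r φ))
    (hC : ∀ r : ℝ, δ ≤ r → ∀ φ : ℝ, |φ| ≤ θ → ‖F (rayPoint r φ)‖ ≤ C * r ^ (-p)) :
    keyholeIntegral δ θ F = 0 := by
  have h := integral_ray_sub_integral_ray (φ₁ := -θ) (φ₂ := θ) hδ (by linarith) hp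
    (fun r hr φ hφ => hF r hr φ (abs_le.2 hφ)) (fun r hr φ hφ => hC r hr φ (abs_le.2 hφ))
  rw [keyholeIntegral, intervalIntegral.integral_symm, ← h]
  abel

/-- Closing to the left: the two rays bound the sector `θ ≤ φ ≤ 2π - θ` around the negative axis, so
`F` must be holomorphic across that axis. The minus sign records the clockwise orientation. -/
theorem keyholeIntegral_eq_neg_circleIntegral {p C : ℝ} (hδ : 0 < δ)
    (hθpi : θ ≤ Real.pi) (hp : 1 < p) {F : ℂ → E} (hFδ : ContinuousOn F (Metric.sphere 0 δ))
    (hF : ∀ r : ℝ, δ ≤ r → ∀ φ ∈ Icc θ (2 * Real.pi - θ), DifferentiableAt ℂ F (rayPoint r φ))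
    (hC : ∀ r : ℝ, δ ≤ r → ∀ φ ∈ Icc θ (2 * Real.pi - θ),
      ‖F (rayPoint r φ)‖ ≤ C * r ^ (-p)) :
    keyholeIntegral δ θ F = -∮ z in C(0, δ), F z := by
  have h := integral_ray_sub_integral_ray hδ (by linarith) hp hF hC
  have hper : ∀ r : ℝ, rayPoint r (2 * Real.pi - θ) = rayPoint r (-θ) := fun r => by
    rw [← rayPoint_add_two_pi r (-θ)]; congr 1; ring
  have hexp : Complex.exp (((2 * Real.pi - θ : ℝ) : ℂ) * Complex.I)
      = Complex.exp (((-θ : ℝ) : ℂ) * Complex.I) := by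
    have := hper 1
    simpa [rayPoint] using this
  have hc : Continuous fun φ : ℝ => (Complex.I * rayPoint δ φ) • F (rayPoint δ φ) := by
    refine ((continuous_rayPoint_right δ).const_mul _).smul
      (hFδ.comp_continuous (continuous_rayPoint_right δ) fun φ => ?_)
    rw [mem_sphere_zero_iff_norm, norm_rayPoint hδ.le]
  -- The arc of the keyhole and the arc obtained from the rays together form the full circle.
  have hadd := intervalIntegral.integral_add_adjacent_intervals (hc.intervalIntegrable (-θ) θ)
    (hc.intervalIntegrable (μ := volume) θ (2 * Real.pi - θ))
  simp only [hper, hexp] at h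
  rw [← integral_arc_eq_circleIntegral δ (-θ), show -θ + 2 * Real.pi = 2 * Real.pi - θ by ring,
    ← hadd, ← h, keyholeIntegral, intervalIntegral.integral_symm]
  abel

end Keyhole

/-! ### Holomorphy and decay of vector-valued Stieltjes transforms. -/

section StieltjesTransform

variable {E : Type*} [NormedAddCommGroup E] [NormedSpace ℂ E] {W : ℝ → E}

/-- The transform `∫ (z + ρ)⁻¹ W(ρ) dρ` over `(0, ∞)`. -/
noncomputable def stieltjesTransform (W : ℝ → E) (z : ℂ) : E :=
  ∫ ρ in Ioi (0 : ℝ), (z + ρ)⁻¹ • W ρ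

theorem aestronglyMeasurable_inv_add_smul (hW : IntegrableOn W (Ioi 0)) {z : ℂ}
    (hz : z ∈ Complex.slitPlane) :
    AEStronglyMeasurable (fun ρ : ℝ => (z + ρ)⁻¹ • W ρ) (volume.restrict (Ioi 0)) :=
  ((continuousOn_inv_add hz).aestronglyMeasurable measurableSet_Ioi).smul hW.1

theorem integrableOn_inv_add_smul (hW : IntegrableOn W (Ioi 0)) {z : ℂ}
    (hz : z ∈ Complex.slitPlane) :
    IntegrableOn (fun ρ : ℝ => (z + ρ)⁻¹ • W ρ) (Ioi 0) := by
  refine Integrable.mono' (hW.norm.const_mul (Real.cos (z.arg / 2) * ‖z‖)⁻¹)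
    (aestronglyMeasurable_inv_add_smul hW hz) ?_
  filter_upwards [ae_restrict_mem measurableSet_Ioi] with ρ hρ
  have h1 := cos_half_arg_pos hz
  have h2 := norm_pos_iff.2 (Complex.slitPlane_ne_zero hz)
  rw [norm_smul, norm_inv]
  refine mul_le_mul_of_nonneg_right (inv_anti₀ (by positivity) ?_) (norm_nonneg _)
  refine le_trans ?_ (cos_half_arg_mul_add_le_norm z (le_of_lt hρ))
  exact mul_le_mul_of_nonneg_left (by linarith [show (0 : ℝ) < ρ from hρ]) h1.le

theorem norm_stieltjesTransform_le {θ : ℝ} (hθ : θ < Real.pi)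
    (hW : IntegrableOn W (Ioi 0)) {r φ : ℝ} (hr : 0 < r) (hφ : |φ| ≤ θ) :
    ‖stieltjesTransform W (rayPoint r φ)‖
      ≤ ((Real.cos (θ / 2))⁻¹ * ∫ ρ in Ioi (0 : ℝ), ‖W ρ‖) * r⁻¹ := by
  have h1 : 0 < Real.cos (θ / 2) := cos_half_pos ((abs_nonneg φ).trans hφ) hθ
  have h := norm_integral_le_of_norm_le (f := fun ρ : ℝ => (rayPoint r φ + ρ)⁻¹ • W ρ)
    (hW.norm.const_mul (Real.cos (θ / 2) * r)⁻¹) (by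
      filter_upwards [ae_restrict_mem measurableSet_Ioi] with ρ hρ
      rw [norm_smul, norm_inv]
      refine mul_le_mul_of_nonneg_right (inv_anti₀ (by positivity) ?_) (norm_nonneg _)
      refine le_trans ?_ (cos_half_mul_add_le_norm hr.le (le_of_lt hρ) hφ hθ.le)
      exact mul_le_mul_of_nonneg_left (by linarith [show (0 : ℝ) < ρ from hρ]) h1.le)
  rw [integral_const_mul, mul_inv] at h
  refine h.trans_eq ?_
  ring

theorem differentiableAt_stieltjesTransform (hW : IntegrableOn W (Ioi 0)) {z : ℂ}
    (hz : z ∈ Complex.slitPlane) : DifferentiableAt ℂ (stieltjesTransform W) z := by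
  obtain ⟨ε, hε, hball⟩ := Metric.isOpen_iff.1 Complex.isOpen_slitPlane z hz
  have hsub : Metric.ball z (ε / 2) ⊆ Complex.slitPlane :=
    (Metric.ball_subset_ball (by linarith)).trans hball
  -- The points `-ρ` lie on the cut, hence outside the ball of radius `ε` about `z`; half of that
  -- distance remains for `w`.
  have hfar : ∀ w ∈ Metric.ball z (ε / 2), ∀ ρ : ℝ, 0 < ρ → ε / 2 ≤ ‖w + ρ‖ := by
    intro w hw ρ hρ
    by_contra! hc
    have h1 : (-(ρ : ℂ)) ∈ Metric.ball z ε := by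
      rw [Metric.mem_ball]
      calc dist (-(ρ : ℂ)) z ≤ dist (-(ρ : ℂ)) w + dist w z := dist_triangle _ _ _
        _ < ε / 2 + ε / 2 := by
          refine add_lt_add ?_ hw
          rwa [dist_comm, dist_eq_norm, sub_neg_eq_add]
        _ = ε := by ring
    rcases hball h1 with h2 | h2
    · simp at h2; linarith
    · simp at h2
  have hmem := Metric.ball_mem_nhds z (half_pos hε)
  have key := hasDerivAt_integral_of_dominated_loc_of_deriv_le (μ := volume.restrict (Ioi (0 : ℝ)))
    (F := fun (w : ℂ) (ρ : ℝ) => (w + ρ)⁻¹ • W ρ)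
    (F' := fun (w : ℂ) (ρ : ℝ) => (-1 / (w + ρ) ^ 2) • W ρ)
    (bound := fun ρ => ((ε / 2) ^ 2)⁻¹ * ‖W ρ‖) hmem ?_ (integrableOn_inv_add_smul hW hz) ?_ ?_
    (hW.norm.const_mul _) ?_
  · exact key.2.differentiableAt
  · filter_upwards [hmem] with w hw using aestronglyMeasurable_inv_add_smul hW (hsub hw)
  · refine (ContinuousOn.aestronglyMeasurable ?_ measurableSet_Ioi).smul hW.1
    exact ContinuousOn.div continuousOn_const (by fun_prop)
      fun ρ hρ => pow_ne_zero 2 (add_ofReal_ne_zero hz (le_of_lt hρ))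
  · filter_upwards [ae_restrict_mem measurableSet_Ioi] with ρ hρ w hw
    have h1 := hfar w hw ρ hρ
    rw [norm_smul, norm_div, norm_neg, norm_one, norm_pow, one_div]
    gcongr
  · filter_upwards [ae_restrict_mem measurableSet_Ioi] with ρ hρ w hw
    have h0 := add_ofReal_ne_zero (hsub hw) (le_of_lt hρ)
    exact (((hasDerivAt_id w).add_const (ρ : ℂ)).inv h0).smul_const (W ρ)

end StieltjesTransform

/-! ### Consequences of the sectorial resolvent estimate. -/

section Sectorial

variable {X : Type*} [NormedAddCommGroup X] [NormedSpace ℂ X]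

/-- The resolvent set of `B` contains the closed disc of radius `δ` and the sector
`θ ≤ |arg z| ≤ π`, and `‖(z I - B)⁻¹‖ ≤ M / |z|` on that sector. -/
structure IsSectorial (B : X →ₗ.[ℂ] X) (δ θ M : ℝ) : Prop where
  closedBall_subset : Metric.closedBall 0 δ ⊆ resolventSetOf B
  rayPoint_mem : ∀ r : ℝ, 0 < r → ∀ φ : ℝ, θ ≤ |φ| → |φ| ≤ Real.pi →
    rayPoint r φ ∈ resolventSetOf B
  norm_le : ∀ r : ℝ, 0 < r → ∀ φ : ℝ, θ ≤ |φ| → |φ| ≤ Real.pi →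
    ‖resolventOf B (rayPoint r φ)‖ ≤ M * r⁻¹

variable {B : X →ₗ.[ℂ] X} {δ θ M : ℝ}

namespace IsSectorial

theorem keyholePoints_subset (h : IsSectorial B δ θ M) (hδ : 0 < δ) (hθpi : θ ≤ Real.pi) :
    keyholePoints δ θ ⊆ resolventSetOf B := by
  rintro _ ⟨r, φ, rfl, hr, hφ, rfl | hφ'⟩
  · apply h.closedBall_subset
    rw [mem_closedBall_zero_iff, norm_rayPoint hδ.le]
  · exact h.rayPoint_mem r (hδ.trans_le hr) φ hφ'.ge (hφ.trans hθpi)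

theorem zero_mem (h : IsSectorial B δ θ M) (hδ : 0 < δ) : (0 : ℂ) ∈ resolventSetOf B :=
  h.closedBall_subset (by simpa using hδ.le)

theorem neg_ofReal_mem (h : IsSectorial B δ θ M) (hθpi : θ ≤ Real.pi) {ρ : ℝ} (hρ : 0 < ρ) :
    -(ρ : ℂ) ∈ resolventSetOf B := by
  rw [← rayPoint_pi]
  have := abs_of_pos Real.pi_pos
  exact h.rayPoint_mem ρ hρ _ (by rwa [this]) this.le

theorem rayPoint_mem_and_norm_le (h : IsSectorial B δ θ M) {r : ℝ}
    (hr : 0 < r) {φ : ℝ} (hφ : φ ∈ Icc θ (2 * Real.pi - θ)) (hθ : 0 ≤ θ) :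
    rayPoint r φ ∈ resolventSetOf B ∧ ‖resolventOf B (rayPoint r φ)‖ ≤ M * r⁻¹ := by
  rcases le_total φ Real.pi with hle | hle
  · have h1 : |φ| = φ := abs_of_nonneg (hθ.trans hφ.1)
    exact ⟨h.rayPoint_mem r hr φ (by rw [h1]; exact hφ.1) (by rwa [h1]),
      h.norm_le r hr φ (by rw [h1]; exact hφ.1) (by rwa [h1])⟩
  · have h1 : |φ - 2 * Real.pi| = 2 * Real.pi - φ := by
      rw [abs_sub_comm]; exact abs_of_nonneg (by linarith [hφ.2])
    have h2 : rayPoint r φ = rayPoint r (φ - 2 * Real.pi) := by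
      rw [← rayPoint_add_two_pi r (φ - 2 * Real.pi), sub_add_cancel]
    rw [h2]
    exact ⟨h.rayPoint_mem r hr _ (by rw [h1]; linarith [hφ.2]) (by rw [h1]; linarith),
      h.norm_le r hr _ (by rw [h1]; linarith [hφ.2]) (by rw [h1]; linarith)⟩

variable [CompleteSpace X]

theorem exists_norm_le_of_mem_closedBall (h : IsSectorial B δ θ M) :
    ∃ C : ℝ, ∀ z ∈ Metric.closedBall (0 : ℂ) δ, ‖resolventOf B z‖ ≤ C :=
  (isCompact_closedBall (0 : ℂ) δ).exists_bound_of_continuousOn fun _ hz =>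
    (differentiableAt_resolventOf (h.closedBall_subset hz)).continuousAt.continuousWithinAt

theorem exists_norm_le_of_mem_keyholePoints (h : IsSectorial B δ θ M) (hδ : 0 < δ)
    (hθpi : θ ≤ Real.pi) :
    ∃ C : ℝ, ∀ z ∈ keyholePoints δ θ, ‖resolventOf B z‖ ≤ C * ‖z‖⁻¹ := by
  obtain ⟨C, hC⟩ := h.exists_norm_le_of_mem_closedBall
  refine ⟨max M (C * δ), ?_⟩
  rintro _ ⟨r, φ, rfl, hr, hφ, hrφ⟩
  have hr0 : 0 < r := hδ.trans_le hr
  rw [norm_rayPoint hr0.le]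
  rcases hrφ with rfl | hφ'
  · have h1 := hC (rayPoint r φ) (by rw [mem_closedBall_zero_iff, norm_rayPoint hr0.le])
    calc _ ≤ C := h1
      _ = C * r * r⁻¹ := by field_simp
      _ ≤ _ := by gcongr; exact le_max_right _ _
  · refine (h.norm_le r hr0 φ hφ'.ge (hφ.trans hθpi)).trans ?_
    gcongr
    exact le_max_left _ _

theorem keyholeIntegrable_cpow_smul (h : IsSectorial B δ θ M) (hδ : 0 < δ) (hθ : 0 ≤ θ)
    (hθpi : θ < Real.pi) {s : ℝ} (hs : s < 0) :
    KeyholeIntegrable δ θ (fun z : ℂ => z ^ (s : ℂ) • resolventOf B z) := by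
  obtain ⟨C, hC⟩ := h.exists_norm_le_of_mem_keyholePoints hδ hθpi.le
  refine KeyholeIntegrable.of_norm_le (p := 1 - s) (C := C) hδ hθ (by linarith)
    (fun z hz => ?_) fun z hz => ?_
  · have hz' := keyholePoints_subset_slitPlane hδ hθpi hz
    exact ((continuousAt_cpow_const hz').smul (differentiableAt_resolventOf
      (h.keyholePoints_subset hδ hθpi.le hz)).continuousAt).continuousWithinAt
  · have hz0 := norm_pos_iff.2
      (Complex.slitPlane_ne_zero (keyholePoints_subset_slitPlane hδ hθpi hz))
    rw [norm_smul, Complex.norm_cpow_real, neg_sub, Real.rpow_sub_one hz0.ne']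
    calc ‖z‖ ^ s * ‖resolventOf B z‖ ≤ ‖z‖ ^ s * (C * ‖z‖⁻¹) :=
          mul_le_mul_of_nonneg_left (hC z hz) (by positivity)
      _ = _ := by ring

theorem keyholeIntegrable_inv_smul (h : IsSectorial B δ θ M) (hδ : 0 < δ) (hθ : 0 ≤ θ)
    (hθpi : θ < Real.pi) :
    KeyholeIntegrable δ θ (fun z : ℂ => z⁻¹ • resolventOf B z) := by
  have := h.keyholeIntegrable_cpow_smul hδ hθ hθpi (s := -1) (by norm_num)
  simpa only [Complex.ofReal_neg, Complex.ofReal_one, Complex.cpow_neg_one] using this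

/-- The factor `z⁻¹` has no branch cut, so the contour can be closed to the left, where the
resolvent exists and the integrand is `O(|z|⁻²)`. Cauchy's formula on the disc then evaluates the
resolvent at `0`. -/
theorem keyholeIntegral_inv_smul (h : IsSectorial B δ θ M) (hδ : 0 < δ) (hθ : 0 ≤ θ)
    (hθpi : θ < Real.pi) :
    keyholeIntegral δ θ (fun z : ℂ => z⁻¹ • resolventOf B z)
      = (2 * (Real.pi : ℂ) * Complex.I) • -resolventOf B 0 := by
  have hd : ∀ z ∈ resolventSetOf B, z ≠ 0 →
      DifferentiableAt ℂ (fun z : ℂ => z⁻¹ • resolventOf B z) z := fun z hz hz0 =>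
    (differentiableAt_inv hz0).smul (differentiableAt_resolventOf hz)
  have hray0 : ∀ r : ℝ, δ ≤ r → ∀ φ : ℝ, rayPoint r φ ≠ 0 := fun r hr φ => by
    rw [← norm_pos_iff, norm_rayPoint (hδ.le.trans hr)]; exact hδ.trans_le hr
  rw [keyholeIntegral_eq_neg_circleIntegral (p := 2) (C := M) hδ hθpi.le (by norm_num)
    (fun z hz => ?_) (fun r hr φ hφ => ?_) fun r hr φ hφ => ?_, smul_neg]
  · have hc := Complex.circleIntegral_sub_center_inv_smul_of_differentiable_on_off_countable hδ
      (f := resolventOf B) (c := 0) countable_empty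
      (fun z hz => (differentiableAt_resolventOf
        (h.closedBall_subset hz)).continuousAt.continuousWithinAt)
      fun z hz => differentiableAt_resolventOf
        (h.closedBall_subset (Metric.ball_subset_closedBall hz.1))
    simp only [sub_zero] at hc
    rw [hc]
  · have hz0 : z ≠ 0 := by
      rintro rfl
      simp at hz
      exact hδ.ne hz
    exact (hd z (h.closedBall_subset (Metric.sphere_subset_closedBall hz))
      hz0).continuousAt.continuousWithinAt
  · exact hd _ (h.rayPoint_mem_and_norm_le (hδ.trans_le hr) hφ hθ).1 (hray0 r hr φ)
  · have hr0 := hδ.trans_le hr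
    have h1 := (h.rayPoint_mem_and_norm_le hr0 hφ hθ).2
    rw [norm_smul, norm_inv, norm_rayPoint hr0.le, Real.rpow_neg hr0.le, Real.rpow_two]
    calc _ ≤ r⁻¹ * (M * r⁻¹) := by gcongr
      _ = _ := by ring

theorem continuousOn_neg_resolventOf_neg (h : IsSectorial B δ θ M) (hθpi : θ ≤ Real.pi) :
    ContinuousOn (fun ρ : ℝ => -resolventOf B (-(ρ : ℂ))) (Ioi 0) := by
  intro ρ hρ
  have h1 := (differentiableAt_resolventOf (h.neg_ofReal_mem hθpi hρ)).continuousAt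
  exact (ContinuousAt.comp (f := fun ρ : ℝ => -(ρ : ℂ)) h1 (by fun_prop)).neg.continuousWithinAt

/-- Compactness of the disc handles `ρ ≤ δ`, the sectorial bound handles `ρ ≥ δ`. -/
theorem exists_norm_neg_resolventOf_neg_le (h : IsSectorial B δ θ M) (hδ : 0 < δ)
    (hθpi : θ ≤ Real.pi) :
    ∃ C : ℝ, ∀ ρ : ℝ, 0 < ρ → ‖-resolventOf B (-(ρ : ℂ))‖ ≤ C * (1 + ρ)⁻¹ := by
  obtain ⟨C, hC⟩ := h.exists_norm_le_of_mem_closedBall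
  have hC0 : 0 ≤ C := (norm_nonneg _).trans (hC 0 (by simpa using hδ.le))
  refine ⟨max (C * (1 + δ)) (M * (1 + δ⁻¹)), fun ρ hρ => ?_⟩
  rw [norm_neg]
  rcases le_total ρ δ with hle | hle
  · calc _ ≤ C := hC _ (by simpa [abs_of_pos hρ] using hle)
      _ = C * (1 + ρ) * (1 + ρ)⁻¹ := by field_simp
      _ ≤ C * (1 + δ) * (1 + ρ)⁻¹ := by gcongr
      _ ≤ _ := by gcongr; exact le_max_left _ _
  · have hp := abs_of_pos Real.pi_pos
    have h1 := h.norm_le ρ hρ Real.pi (by rwa [hp]) hp.le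
    rw [rayPoint_pi] at h1
    have hM : 0 ≤ M := by
      by_contra! hc
      have := (norm_nonneg _).trans h1
      have h2 : 0 < ρ⁻¹ := inv_pos.2 hρ
      nlinarith
    have h3 : ρ⁻¹ * (1 + ρ) ≤ 1 + δ⁻¹ := by
      have : ρ⁻¹ ≤ δ⁻¹ := inv_anti₀ hδ hle
      have h4 : ρ⁻¹ * (1 + ρ) = ρ⁻¹ + 1 := by field_simp
      linarith
    calc _ ≤ M * ρ⁻¹ := h1
      _ = M * (ρ⁻¹ * (1 + ρ)) * (1 + ρ)⁻¹ := by field_simp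
      _ ≤ M * (1 + δ⁻¹) * (1 + ρ)⁻¹ := by gcongr
      _ ≤ _ := by gcongr; exact le_max_right _ _

end IsSectorial

end Sectorial

/-! ### The Balakrishnan operator inverts `B^α + t`. -/

section Balakrishnan

variable {X : Type*} [NormedAddCommGroup X] [NormedSpace ℂ X]

/-- The operator `(sin πα / π) ∫ (ρ + B)⁻¹ fracKernel α t ρ dρ`, with `(ρ + B)⁻¹` written as
`-(-ρ - B)⁻¹`. -/
noncomputable def balakrishnan (B : X →ₗ.[ℂ] X) (α t : ℝ) : X →L[ℂ] X :=
  ((Real.sin (Real.pi * α) / Real.pi : ℝ) : ℂ) •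
    ∫ ρ in Ioi (0 : ℝ), (fracKernel α t ρ : ℂ) • -resolventOf B (-(ρ : ℂ))

variable {B : X →ₗ.[ℂ] X} {δ θ M α t : ℝ}

namespace IsSectorial

variable [CompleteSpace X]

theorem integrableOn_fracKernel_smul_resolventOf (h : IsSectorial B δ θ M) (hδ : 0 < δ)
    (hθpi : θ ≤ Real.pi) (hα : 0 < α) (hα1 : α < 1) (ht : 0 ≤ t) :
    IntegrableOn (fun ρ : ℝ => (fracKernel α t ρ : ℂ) • -resolventOf B (-(ρ : ℂ))) (Ioi 0) := by
  obtain ⟨C, hC⟩ := h.exists_norm_neg_resolventOf_neg_le hδ hθpi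
  exact integrableOn_fracKernel_smul hα hα1 ht (h.continuousOn_neg_resolventOf_neg hθpi) hC

theorem commute_resolventOf_balakrishnan (h : IsSectorial B δ θ M) (hδ : 0 < δ)
    (hθpi : θ ≤ Real.pi) (hα : 0 < α) (hα1 : α < 1) (ht : 0 ≤ t) {z : ℂ}
    (hz : z ∈ resolventSetOf B) : Commute (resolventOf B z) (balakrishnan B α t) := by
  have hint := h.integrableOn_fracKernel_smul_resolventOf hδ hθpi hα hα1 ht
  refine Commute.smul_right ?_ _
  have h1 := (ContinuousLinearMap.mul ℂ (X →L[ℂ] X) (resolventOf B z)).integral_comp_comm hint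
  have h2 := ((ContinuousLinearMap.mul ℂ (X →L[ℂ] X)).flip (resolventOf B z)).integral_comp_comm
    hint
  simp only [ContinuousLinearMap.mul_apply', ContinuousLinearMap.flip_apply] at h1 h2
  rw [Commute, SemiconjBy, ← h1, ← h2]
  refine setIntegral_congr_fun measurableSet_Ioi fun ρ hρ => ?_
  exact (((resolventOf_commute hz (h.neg_ofReal_mem hθpi hρ)).neg_right).smul_right _).eq

/-- The partial fraction form of the resolvent identity splits the integrand into a scalar multiple
of the resolvent at `z`, summed by the Stieltjes representation, and a term whose `z`-dependence is
only through `(z + ρ)⁻¹`. -/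
theorem resolventOf_mul_balakrishnan (h : IsSectorial B δ θ M) (hδ : 0 < δ)
    (hθpi : θ ≤ Real.pi) (hα : 0 < α) (hα1 : α < 1) (ht : 0 ≤ t) {z : ℂ}
    (hz : z ∈ resolventSetOf B) (hzs : z ∈ Complex.slitPlane) :
    resolventOf B z * balakrishnan B α t = (z ^ (α : ℂ) + t)⁻¹ • resolventOf B z +
      ((Real.sin (Real.pi * α) / Real.pi : ℝ) : ℂ) • stieltjesTransform
        (fun ρ : ℝ => (fracKernel α t ρ : ℂ) • -resolventOf B (-(ρ : ℂ))) z := by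
  have hint := h.integrableOn_fracKernel_smul_resolventOf hδ hθpi hα hα1 ht
  have hker := integrableOn_fracKernel_mul_inv_add hα hα1 ht hzs
  have h1 := (ContinuousLinearMap.mul ℂ (X →L[ℂ] X) (resolventOf B z)).integral_comp_comm hint
  simp only [ContinuousLinearMap.mul_apply'] at h1
  have h3 := integral_smul_const (μ := volume.restrict (Ioi 0))
    (fun ρ : ℝ => (fracKernel α t ρ : ℂ) * (z + ρ)⁻¹) (resolventOf B z)
  rw [balakrishnan, mul_smul_comm, ← h1, ← integral_fracKernel_mul_inv_add hα hα1 ht hzs, mul_smul,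
    ← smul_add, ← h3, stieltjesTransform,
    ← integral_add (hker.smul_const _) (integrableOn_inv_add_smul hint hzs)]
  congr 1
  refine setIntegral_congr_fun measurableSet_Ioi fun ρ hρ => ?_
  have h2 := resolventOf_mul_neg_resolventOf_neg hz (h.neg_ofReal_mem hθpi hρ)
    (add_ofReal_ne_zero hzs (le_of_lt hρ))
  simp only [mul_smul_comm]
  rw [h2, smul_add, smul_add, smul_smul, smul_comm]

/-- The central identity. Both terms of the left factor are keyhole integrals over the same contour,
so the product is a single keyhole integral, and its integrand splits into one part that closes to
the left and one that closes to the right. -/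
theorem dunfordTaylor_add_smul_mul_balakrishnan (h : IsSectorial B δ θ M) (hδ : 0 < δ)
    (hθ : 0 ≤ θ) (hθpi : θ < Real.pi) (hα : 0 < α) (hα1 : α < 1) (ht : 0 ≤ t) :
    (dunfordTaylor B δ θ (α - 1) + (t : ℂ) • -resolventOf B 0) * balakrishnan B α t
      = -resolventOf B 0 := by
  have h2pi : (2 * (Real.pi : ℂ) * Complex.I) ≠ 0 := by
    simp [Real.pi_ne_zero]
  have hA : -resolventOf B 0 = (2 * (Real.pi : ℂ) * Complex.I)⁻¹ •
      keyholeIntegral δ θ (fun z : ℂ => z⁻¹ • resolventOf B z) := by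
    rw [h.keyholeIntegral_inv_smul hδ hθ hθpi, inv_smul_smul₀ h2pi]
  -- On the contour `g(z) = (z^α + t)/z`, so `g` cancels `(z^α + t)⁻¹` and leaves `z⁻¹`.
  set g : ℂ → ℂ := fun z => z ^ ((α - 1 : ℝ) : ℂ) + t * z⁻¹ with hg
  set W : ℝ → X →L[ℂ] X := fun ρ => (fracKernel α t ρ : ℂ) • -resolventOf B (-(ρ : ℂ)) with hW
  have hWint : IntegrableOn W (Ioi 0) :=
    h.integrableOn_fracKernel_smul_resolventOf hδ hθpi.le hα hα1 ht
  set J : ℂ → X →L[ℂ] X := fun z =>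
    g z • ((Real.sin (Real.pi * α) / Real.pi : ℝ) : ℂ) • stieltjesTransform W z with hJ
  have hI1 := h.keyholeIntegrable_cpow_smul hδ hθ hθpi (s := α - 1) (by linarith)
  have hI2 := h.keyholeIntegrable_inv_smul hδ hθ hθpi
  have hI2' : KeyholeIntegrable δ θ (fun z : ℂ => (t : ℂ) • z⁻¹ • resolventOf B z) :=
    ⟨hI2.1.smul (t : ℂ), hI2.2.1.smul (t : ℂ), hI2.2.2.smul (t : ℂ)⟩
  have hsum : dunfordTaylor B δ θ (α - 1) + (t : ℂ) • -resolventOf B 0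
      = (2 * (Real.pi : ℂ) * Complex.I)⁻¹ •
        keyholeIntegral δ θ (fun z : ℂ => g z • resolventOf B z) := by
    have h1 := keyholeIntegral_clm ((t : ℂ) • ContinuousLinearMap.id ℂ (X →L[ℂ] X)) hI2
    rw [hA, dunfordTaylor, smul_comm (t : ℂ), ← smul_add]
    congr 1
    have h1' : keyholeIntegral δ θ (fun z : ℂ => (t : ℂ) • z⁻¹ • resolventOf B z)
      = (t : ℂ) • keyholeIntegral δ θ (fun z : ℂ => z⁻¹ • resolventOf B z) := h1
    rw [← h1', ← keyholeIntegral_add hI1 hI2']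
    simp only [hg, add_smul, mul_smul]
  have hgI : KeyholeIntegrable δ θ (fun z : ℂ => g z • resolventOf B z) := by
    refine KeyholeIntegrable.congr hθ (F := fun z : ℂ => z ^ ((α - 1 : ℝ) : ℂ) • resolventOf B z
      + (t : ℂ) • z⁻¹ • resolventOf B z)
      ⟨hI1.1.add hI2'.1, hI1.2.1.add hI2'.2.1, hI1.2.2.add hI2'.2.2⟩ fun z _ => ?_
    simp only [hg, add_smul, mul_smul]
  have hJd : ∀ z ∈ Complex.slitPlane, DifferentiableAt ℂ J z := by
    intro z hz
    have h1 : DifferentiableAt ℂ g z :=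
      (Complex.hasStrictDerivAt_cpow_const hz).hasDerivAt.differentiableAt.add
        ((differentiableAt_inv (Complex.slitPlane_ne_zero hz)).const_mul _)
    exact h1.smul ((differentiableAt_stieltjesTransform hWint hz).const_smul
      ((Real.sin (Real.pi * α) / Real.pi : ℝ) : ℂ))
  obtain ⟨C, hC⟩ : ∃ C : ℝ, ∀ r : ℝ, δ ≤ r → ∀ φ : ℝ, |φ| ≤ θ →
      ‖J (rayPoint r φ)‖ ≤ C * r ^ (-(2 - α)) := by
    -- The first factor bounds `g`: for `r ≥ δ`, `t r⁻¹ = t r^(-α) r^(α-1) ≤ t δ^(-α) r^(α-1)`. The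
    -- transform supplies a further `r⁻¹`, and `2 - α > 1`.
    refine ⟨(1 + t * δ ^ (-α)) * (‖((Real.sin (Real.pi * α) / Real.pi : ℝ) : ℂ)‖ *
      ((Real.cos (θ / 2))⁻¹ * ∫ ρ in Ioi (0 : ℝ), ‖W ρ‖)), fun r hr φ hφ => ?_⟩
    have hr0 := hδ.trans_le hr
    have h1 := norm_stieltjesTransform_le hθpi hWint hr0 hφ
    have h2 : ‖g (rayPoint r φ)‖ ≤ (1 + t * δ ^ (-α)) * r ^ (α - 1) := by
      have h3 : r⁻¹ = r ^ (-α) * r ^ (α - 1) := by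
        rw [← Real.rpow_add hr0, ← Real.rpow_neg_one]; ring_nf
      have h4 : r ^ (-α) ≤ δ ^ (-α) := Real.rpow_le_rpow_of_nonpos hδ hr (by linarith)
      refine (norm_add_le _ _).trans ?_
      rw [Complex.norm_cpow_real, norm_mul, norm_inv, norm_rayPoint hr0.le, Complex.norm_real,
        Real.norm_of_nonneg ht, h3, add_mul, one_mul, mul_assoc]
      gcongr
    have h5 : r ^ (-(2 - α)) = r ^ (α - 1) * r⁻¹ := by
      rw [← Real.rpow_neg_one r, ← Real.rpow_add hr0]; ring_nf
    rw [hJ, norm_smul, norm_smul, h5]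
    calc _ ≤ ((1 + t * δ ^ (-α)) * r ^ (α - 1)) *
          (‖((Real.sin (Real.pi * α) / Real.pi : ℝ) : ℂ)‖ *
            (((Real.cos (θ / 2))⁻¹ * ∫ ρ in Ioi (0 : ℝ), ‖W ρ‖) * r⁻¹)) := by gcongr
      _ = _ := by ring
  have hJ0 : keyholeIntegral δ θ J = 0 :=
    keyholeIntegral_eq_zero hδ hθ (p := 2 - α) (by linarith)
      (fun r hr φ hφ => hJd _ (rayPoint_mem_slitPlane (hδ.trans_le hr) (hφ.trans_lt hθpi))) hC
  have hJI : KeyholeIntegrable δ θ J := by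
    refine KeyholeIntegrable.of_norm_le hδ hθ (p := 2 - α) (C := C) (by linarith)
      (fun z hz => (hJd z
        (keyholePoints_subset_slitPlane hδ hθpi hz)).continuousAt.continuousWithinAt) ?_
    rintro _ ⟨r, φ, rfl, hr, hφ, -⟩
    rw [norm_rayPoint (hδ.le.trans hr)]
    exact hC r hr φ hφ
  have hmul := keyholeIntegral_clm
    ((ContinuousLinearMap.mul ℂ (X →L[ℂ] X)).flip (balakrishnan B α t)) hgI
  simp only [ContinuousLinearMap.mul_apply', ContinuousLinearMap.flip_apply] at hmul
  rw [hsum, smul_mul_assoc, ← hmul]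
  nth_rw 1 [hA]
  congr 1
  rw [keyholeIntegral_congr hθ (G := fun z => z⁻¹ • resolventOf B z + J z) fun z hz => ?_,
    keyholeIntegral_add hI2 hJI, hJ0, add_zero]
  have hzs := keyholePoints_subset_slitPlane hδ hθpi hz
  have hz0 := Complex.slitPlane_ne_zero hzs
  have hne : z ^ (α : ℂ) + t ≠ 0 := by
    rw [Complex.cpow_def_of_ne_zero hz0, mul_comm]
    refine exp_mul_add_ne_zero hα hα1 ht ?_
    rw [Complex.log_im]
    exact Complex.abs_arg_le_pi z
  have hgf : g z * (z ^ (α : ℂ) + t)⁻¹ = z⁻¹ := by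
    rw [hg]
    simp only
    rw [Complex.ofReal_sub, Complex.ofReal_one, Complex.cpow_sub _ _ hz0, Complex.cpow_one]
    field_simp
  rw [smul_mul_assoc, h.resolventOf_mul_balakrishnan hδ hθpi.le hα hα1 ht
    (h.keyholePoints_subset hδ hθpi.le hz) hzs, smul_add, smul_smul, hgf]

theorem commute_dunfordTaylor_balakrishnan (h : IsSectorial B δ θ M) (hδ : 0 < δ)
    (hθ : 0 ≤ θ) (hθpi : θ < Real.pi) (hα : 0 < α) (hα1 : α < 1) (ht : 0 ≤ t) :
    Commute (dunfordTaylor B δ θ (α - 1)) (balakrishnan B α t) := by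
  have hI := h.keyholeIntegrable_cpow_smul hδ hθ hθpi (s := α - 1) (by linarith)
  refine Commute.smul_left ?_ _
  have h1 := keyholeIntegral_clm
    (ContinuousLinearMap.mul ℂ (X →L[ℂ] X) (balakrishnan B α t)) hI
  have h2 := keyholeIntegral_clm
    ((ContinuousLinearMap.mul ℂ (X →L[ℂ] X)).flip (balakrishnan B α t)) hI
  simp only [ContinuousLinearMap.mul_apply', ContinuousLinearMap.flip_apply] at h1 h2
  rw [Commute, SemiconjBy, ← h1, ← h2]
  refine keyholeIntegral_congr hθ fun z hz => ?_
  exact ((h.commute_resolventOf_balakrishnan hδ hθpi.le hα hα1 ht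
    (h.keyholePoints_subset hδ hθpi.le hz)).smul_left _).eq

theorem isBoundedInverse_balakrishnan (h : IsSectorial B δ θ M) (hδ : 0 < δ)
    (hθ : 0 ≤ θ) (hθpi : θ < Real.pi) (hα : 0 < α) (hα1 : α < 1) (ht : 0 ≤ t) :
    IsBoundedInverse (addScalar (t : ℂ) (fracPower B δ θ α)) (balakrishnan B α t) := by
  have h0 := h.zero_mem hδ
  have hA : IsBoundedInverse B (-resolventOf B 0) := by
    have := isBoundedInverse_neg_resolventOf_neg (B := B) (z := 0) (by rwa [neg_zero])
    rwa [isBoundedInverse_addScalar_zero_iff, neg_zero] at this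
  exact isBoundedInverse_addScalar_fracPower hA
    (h.dunfordTaylor_add_smul_mul_balakrishnan hδ hθ hθpi hα hα1 ht)
    (h.commute_dunfordTaylor_balakrishnan hδ hθ hθpi hα hα1 ht)
    (h.commute_resolventOf_balakrishnan hδ hθpi.le hα hα1 ht h0).neg_left

end IsSectorial

theorem exists_isSectorial {ω lam : ℝ}
    (hres : negSector ω ∪ Metric.ball (0 : ℂ) lam ⊆ resolventSetOf B)
    (hbound : ∀ η : ℝ, 0 < η → η < ω → ∃ M : ℝ, ∀ z ∈ negSector η,
      ‖z‖ * ‖resolventOf B z‖ ≤ M)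
    (hδlam : δ < lam) (hθ : Real.pi - ω < θ) (hθpi : θ < Real.pi) :
    ∃ M : ℝ, IsSectorial B δ θ M := by
  -- The sector is defined by a strict inequality, so `η > π - θ` is needed for it to contain the
  -- rays `|arg z| = θ` themselves.
  obtain ⟨η, hη1, hη2⟩ := exists_between (show Real.pi - θ < ω by linarith)
  obtain ⟨M, hM⟩ := hbound η (by linarith) hη2
  have hmem : ∀ r : ℝ, 0 < r → ∀ φ : ℝ, θ ≤ |φ| → |φ| ≤ Real.pi →
      rayPoint r φ ∈ negSector η := by
    intro r hr φ h1 h2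
    change Real.pi - |(rayPoint r φ).arg| < η
    -- At `φ = -π` the principal argument is `π`, not `φ`.
    rcases eq_or_ne φ (-Real.pi) with rfl | hne
    · rw [rayPoint_neg_pi, ← rayPoint_pi, arg_rayPoint hr ⟨by linarith [Real.pi_pos], le_rfl⟩,
        abs_of_pos Real.pi_pos]
      linarith
    · rw [arg_rayPoint hr ⟨lt_of_le_of_ne (abs_le.1 h2).1 hne.symm, (abs_le.1 h2).2⟩]
      linarith
  refine ⟨M, fun z hz => hres (Or.inr ?_), fun r hr φ h1 h2 => hres (Or.inl ?_),
    fun r hr φ h1 h2 => ?_⟩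
  · exact Metric.closedBall_subset_ball hδlam hz
  · exact lt_trans (hmem r hr φ h1 h2) hη2
  · have := hM _ (hmem r hr φ h1 h2)
    rw [norm_rayPoint hr.le] at this
    rw [← div_eq_mul_inv, le_div_iff₀ hr, mul_comm]
    exact this

end Balakrishnan

end UnboundedOp

theorem mainTheorem4 {X : Type*} [NormedAddCommGroup X] [NormedSpace ℂ X] [CompleteSpace X]
    (B : X →ₗ.[ℂ] X) (ω lam : ℝ) (hω : 0 < ω) (hωpi : ω < Real.pi) (hlam : 0 < lam)
    -- the resolvent set contains the sector and the disc
    (hres : UnboundedOp.negSector ω ∪ Metric.ball (0 : ℂ) lam ⊆ UnboundedOp.resolventSetOf B)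
    -- `z (z I - B)⁻¹` is bounded on every smaller sector
    (hbound : ∀ η : ℝ, 0 < η → η < ω → ∃ M : ℝ, ∀ z ∈ UnboundedOp.negSector η,
      ‖z‖ * ‖UnboundedOp.resolventOf B z‖ ≤ M)
    -- the contour in the definition of `B^α`
    (δ θ : ℝ) (hδ : 0 < δ) (hδlam : δ < lam) (hθ : Real.pi - ω < θ) (hθpi : θ < Real.pi)
    (α : ℝ) (hα : 0 < α) (hα1 : α < 1) :
    UnboundedOp.KeyholeIntegrable δ θ
      (fun z : ℂ => z ^ ((α - 1 : ℝ) : ℂ) • UnboundedOp.resolventOf B z) ∧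
    (∀ t : ℝ, 0 ≤ t →
      IntegrableOn (fun ρ : ℝ =>
        ((ρ ^ α / (ρ ^ (2 * α) + 2 * t * Real.cos (Real.pi * α) * ρ ^ α + t ^ 2) : ℝ) : ℂ) •
          UnboundedOp.boundedInverse (UnboundedOp.addScalar (ρ : ℂ) B)) (Ioi 0) ∧
      UnboundedOp.IsBoundedInverse
        (UnboundedOp.addScalar (t : ℂ) (UnboundedOp.fracPower B δ θ α))
        (((Real.sin (Real.pi * α) / Real.pi : ℝ) : ℂ) • ∫ ρ in Ioi (0 : ℝ),
          ((ρ ^ α / (ρ ^ (2 * α) + 2 * t * Real.cos (Real.pi * α) * ρ ^ α + t ^ 2) : ℝ) : ℂ) •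
            UnboundedOp.boundedInverse (UnboundedOp.addScalar (ρ : ℂ) B))) ∧
    (IntegrableOn (fun ρ : ℝ => ((ρ ^ (-α) : ℝ) : ℂ) •
        UnboundedOp.boundedInverse (UnboundedOp.addScalar (ρ : ℂ) B)) (Ioi 0) ∧
      UnboundedOp.IsBoundedInverse (UnboundedOp.fracPower B δ θ α)
        (((Real.sin (Real.pi * α) / Real.pi : ℝ) : ℂ) • ∫ ρ in Ioi (0 : ℝ),
          ((ρ ^ (-α) : ℝ) : ℂ) •
            UnboundedOp.boundedInverse (UnboundedOp.addScalar (ρ : ℂ) B))) := by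
  have hθ0 : 0 ≤ θ := by linarith
  obtain ⟨M, h⟩ := UnboundedOp.exists_isSectorial hres hbound hδlam hθ hθpi
  have hinv : ∀ ρ ∈ Ioi (0 : ℝ), UnboundedOp.boundedInverse (UnboundedOp.addScalar (ρ : ℂ) B)
      = -UnboundedOp.resolventOf B (-(ρ : ℂ)) := fun ρ hρ =>
    UnboundedOp.boundedInverse_addScalar (h.neg_ofReal_mem hθpi.le hρ)
  -- The kernel `k` is left free so that one argument also covers `ρ^(-α)`, the simplified form for
  -- `t = 0`; agreement is needed only for `ρ > 0`.
  have hmain : ∀ t : ℝ, 0 ≤ t → ∀ k : ℝ → ℝ,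
      (∀ ρ ∈ Ioi (0 : ℝ), k ρ = UnboundedOp.fracKernel α t ρ) →
      IntegrableOn (fun ρ : ℝ =>
        (k ρ : ℂ) • UnboundedOp.boundedInverse (UnboundedOp.addScalar (ρ : ℂ) B)) (Ioi 0) ∧
      UnboundedOp.IsBoundedInverse
        (UnboundedOp.addScalar (t : ℂ) (UnboundedOp.fracPower B δ θ α))
        (((Real.sin (Real.pi * α) / Real.pi : ℝ) : ℂ) • ∫ ρ in Ioi (0 : ℝ),
          (k ρ : ℂ) • UnboundedOp.boundedInverse (UnboundedOp.addScalar (ρ : ℂ) B)) := by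
    intro t ht k hk
    have heq : EqOn (fun ρ : ℝ => (UnboundedOp.fracKernel α t ρ : ℂ) •
        -UnboundedOp.resolventOf B (-(ρ : ℂ))) (fun ρ : ℝ =>
        (k ρ : ℂ) • UnboundedOp.boundedInverse (UnboundedOp.addScalar (ρ : ℂ) B)) (Ioi 0) := by
      intro ρ hρ
      simp only [hk ρ hρ, hinv ρ hρ]
    refine ⟨(h.integrableOn_fracKernel_smul_resolventOf hδ hθpi.le hα hα1 ht).congr_fun heq
      measurableSet_Ioi, ?_⟩
    rw [← setIntegral_congr_fun measurableSet_Ioi heq]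
    exact h.isBoundedInverse_balakrishnan hδ hθ0 hθpi hα hα1 ht
  refine ⟨h.keyholeIntegrable_cpow_smul hδ hθ0 hθpi (by linarith),
    fun t ht => hmain t ht _ fun _ _ => rfl, ?_⟩
  have h0 := hmain 0 le_rfl (fun ρ => ρ ^ (-α)) fun ρ hρ => by
    have hp : 0 < ρ ^ α := Real.rpow_pos_of_pos hρ α
    rw [UnboundedOp.fracKernel, two_mul α, Real.rpow_add hρ, Real.rpow_neg (le_of_lt hρ)]
    field_simp
    ring
  rwa [Complex.ofReal_zero, UnboundedOp.isBoundedInverse_addScalar_zero_iff] at h0
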